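/- Let $\Bbbk$ be a field. A combinatorial Hopf algebra over $\Bbbk$ is a pair $({\mathcal H},\zeta)$ where ${\mathcal H}=\bigoplus_{n\ge 0}{\mathcal H}_n$ is a graded connected Hopf algebra over $\Bbbk$ (${\mathcal H}_0=\Bbbk\cdot 1$ and all structure maps preserve the grading) with every ${\mathcal H}_n$ finite-dimensional, and $\zeta:{\mathcal H}\to\Bbbk$ is a character, i.e. a morphism of algebras. A morphism $({\mathcal H}',\zeta')\to({\mathcal H},\zeta)$ is a morphism of graded Hopf algebras $\alpha:{\mathcal H}'\to{\mathcal H}$ with $\zeta\circ\alpha=\zeta'$. Let $\bar\zeta(h)=(-1)^n\zeta(h)$ for $h\in{\mathcal H}_n$, and let $\zeta^{-1}=\zeta\circ S_{\mathcal H}$ be the inverse of $\zeta$ under convolution, $S_{\mathcal H}$ being the antipode. The pair $({\mathcal H},\zeta)$ is even if $\bar\zeta=\zeta$, and odd if $\bar\zeta=\zeta^{-1}$; even (odd) combinatorial Hopf algebras form a full subcategory of the category of combinatorial Hopf algebras. The even (respectively odd) subalgebra of $({\mathcal H},\zeta)$ is the largest graded subcoalgebra of ${\mathcal H}$ on which $\bar\zeta$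 and $\zeta$ (respectively $\bar\zeta$ and $\zeta^{-1}$) agree. Let ${\mathcal Q}{\mathit{Sym}}$ be the Hopf algebra of quasi-symmetric functions over $\Bbbk$, with linear basis the monomial quasi-symmetric functions $M_{(a_1,\ldots,a_k)}=\sum_{i_1<\cdots<i_k}x_{i_1}^{a_1}\cdots x_{i_k}^{a_k}$, the product of power series, the coproduct $\Delta(M_\alpha)=\sum_{\alpha=\beta\gamma}M_\beta\otimes M_\gamma$ (sum over deconcatenations), and the grading in which $M_{(a_1,\ldots,a_k)}$ has degree $a_1+\cdots+a_k$. Let $\zeta_{\mathcal Q}$ be the character of ${\mathcal Q}{\mathit{Sym}}$ that sets the first variable to $1$ and all other variables to $0$. Let $\Pi_+$ and $\Pi_-$ be the even and the odd subalgebra of $({\mathcal Q}{\mathit{Sym}},\zeta_{\mathcal Q})$. For every combinatorial Hopf algebra $({\mathcal H},\zeta)$ there is a unique morphism $\Psi:({\mathcal H},\zeta)\to({\mathcal Q}{\mathit{Sym}},\zeta_{\mathcal Q})$; if $\zeta$ is even then $\mathrm{Im}(\Psi)\subseteq\Pi_+$, and if $\zeta$ is odd then $\mathrm{Im}(\Psi)\subseteq\Pi_-$.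 Moreover $\Pi_+$ and $\Pi_-$, with the structure inherited from ${\mathcal Q}{\mathit{Sym}}$ and the restriction of $\zeta_{\mathcal Q}$, are an even and an odd combinatorial Hopf algebra respectively, and $(\Pi_+,\zeta_{\mathcal Q})$ and $(\Pi_-,\zeta_{\mathcal Q})$ are terminal objects in the categories of even and of odd combinatorial Hopf algebras, respectively. -/

import Mathlib

universe u v w

noncomputable section

open scoped TensorProduct

namespace QuasiSym

section Parts

variable {L L' : Type*} [LinearOrder L] [LinearOrder L']

/-- The composition attached to a monomial `∏ x_i ^ (e i)` in a linearly ordered alphabet: the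
list of its nonzero exponents, read in increasing order of the variables. The monomial
`x_{i₁}^{a₁} ⋯ x_{iₖ}^{aₖ}` with `i₁ < ⋯ < iₖ` and all `aⱼ ≥ 1` has composition `[a₁, …, aₖ]`. -/
def parts (e : L →₀ ℕ) : List ℕ+ :=
  e.support.sort.map fun i => (e i).toPNat'

/-- The exponent vector `(a₁, …, aₖ)` of a composition `[a₁, …, aₖ]`. -/
def vec (α : List ℕ+) : Fin α.length →₀ ℕ :=
  Finsupp.equivFunOnFinite.symm fun i => (α.get i : ℕ)

/-- The exponent of the monomial `x_0^{a₁} x_1^{a₂} ⋯` attached to a composition. -/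
def std (α : List ℕ+) : ℕ →₀ ℕ := (vec α).embDomain Fin.valEmbedding

theorem parts_embDomain (j : L ↪ L') (hj : StrictMono j) (e : L →₀ ℕ) :
    parts (e.embDomain j) = parts e := by
  unfold parts
  rw [Finsupp.support_embDomain]
  have : (e.support.map j).sort = e.support.sort.map j :=
    ((hj.strictMonoOn _).map_finsetSort).symm
  rw [this, List.map_map]
  congr 1
  funext i
  simp [Finsupp.embDomain_apply_self]

theorem parts_vec (α : List ℕ+) : parts (vec α) = α := by
  have hs : (vec α).support = Finset.univ := by
    ext i; simp [vec]
  unfold parts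
  rw [hs, Fin.sort_univ]
  have hf : (fun i => (vec α i).toPNat') = α.get := by
    funext i
    simp [vec, PNat.coe_toPNat']
  rw [hf, ← List.ofFn_eq_map, List.ofFn_get]

theorem parts_std (α : List ℕ+) : parts (std α) = α := by
  rw [std, parts_embDomain _ (fun _ _ h => h), parts_vec]

theorem eq_embDomain_vec (e : L →₀ ℕ) :
    ∃ j : Fin (parts e).length ↪ L, StrictMono j ∧ e = (vec (parts e)).embDomain j := by
  have hc : e.support.card = (parts e).length := by simp [parts]
  refine ⟨(e.support.orderEmbOfFin hc).toEmbedding, (e.support.orderEmbOfFin hc).strictMono, ?_⟩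
  ext x
  by_cases hx : x ∈ e.support
  · have : x ∈ Set.range (e.support.orderEmbOfFin hc) := by
      rw [Finset.range_orderEmbOfFin]; exact hx
    obtain ⟨i, rfl⟩ := this
    have h2 : e (e.support.orderEmbOfFin hc i) ≠ 0 := Finsupp.mem_support_iff.1 hx
    erw [Finsupp.embDomain_apply_self]
    simp only [vec, Finsupp.equivFunOnFinite_symm_apply_apply, List.get_eq_getElem]
    have : (parts e)[(i : ℕ)] = (e (e.support.orderEmbOfFin hc i)).toPNat' := by
      simp only [parts, List.getElem_map]
      rfl
    rw [this, Nat.toPNat'_coe]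
    simp [Nat.pos_of_ne_zero h2]
  · rw [Finsupp.embDomain_of_notMem_range]
    · simpa using hx
    · rintro ⟨i, rfl⟩
      exact hx (Finset.orderEmbOfFin_mem e.support hc i)

theorem degree_eq (e : L →₀ ℕ) : e.degree = ((parts e).map (fun a : ℕ+ => (a : ℕ))).sum := by
  unfold parts
  rw [List.map_map, Finsupp.degree_apply, ← Finset.sum_map_toList]
  refine ((e.support.sort_perm_toList (· ≤ ·)).symm.map _).sum_eq.trans ?_
  congr 1
  refine List.map_congr_left fun i hi => ?_
  have : e i ≠ 0 := by simpa using hi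
  simp [Nat.toPNat'_coe, Nat.pos_of_ne_zero this]

open Classical in
theorem sum_antidiagonal_embDomain {A : Type*} [AddCommMonoid A] (F : List ℕ+ → List ℕ+ → A)
    (j : L ↪ L') (hj : StrictMono j) (e : L →₀ ℕ) :
    ∑ p ∈ Finset.HasAntidiagonal.antidiagonal (e.embDomain j), F (parts p.1) (parts p.2) =
      ∑ p ∈ Finset.HasAntidiagonal.antidiagonal e, F (parts p.1) (parts p.2) := by
  rw [← Finsupp.image_prodMap_embDomain_antidiagonal, Finset.sum_image]
  · simp [parts_embDomain j hj]
  · exact ((Finsupp.embDomain_injective j).prodMap (Finsupp.embDomain_injective j)).injOn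

open Classical in
theorem sum_antidiagonal_eq {A : Type*} [AddCommMonoid A] (F : List ℕ+ → List ℕ+ → A)
    (e : L →₀ ℕ) :
    ∑ p ∈ Finset.HasAntidiagonal.antidiagonal e, F (parts p.1) (parts p.2) =
      ∑ p ∈ Finset.HasAntidiagonal.antidiagonal (vec (parts e)), F (parts p.1) (parts p.2) := by
  obtain ⟨j, hj, he⟩ := eq_embDomain_vec e
  conv_lhs => rw [he]
  exact sum_antidiagonal_embDomain F j hj _

theorem parts_sumElim {m n : ℕ} (p : Fin m →₀ ℕ) (q : Fin n →₀ ℕ) :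
    parts ((p.sumElim q).embDomain finSumFinEquiv.toEmbedding) = parts p ++ parts q := by
  have h : ((p.sumElim q).embDomain finSumFinEquiv.toEmbedding).support.sort =
      p.support.sort.map (Fin.castAdd n) ++ q.support.sort.map (Fin.natAdd m) := by
    have hnd : (p.support.sort.map (Fin.castAdd n) ++
        q.support.sort.map (Fin.natAdd m)).Nodup := by
      refine List.Nodup.append ((p.support.sort_nodup _).map (Fin.castAdd_injective _ _))
        ((q.support.sort_nodup _).map (Fin.natAdd_injective _ _)) ?_
      intro x hx hy
      simp only [List.mem_map] at hx hy
      obtain ⟨a, -, rfl⟩ := hx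
      obtain ⟨b, -, hb⟩ := hy
      have := congrArg Fin.val hb
      simp at this
      omega
    have hp : (p.support.sort.map (Fin.castAdd n) ++
        q.support.sort.map (Fin.natAdd m)).Pairwise (· ≤ ·) := by
      rw [List.pairwise_append]
      refine ⟨?_, ?_, ?_⟩
      · rw [List.pairwise_map]
        exact (p.support.pairwise_sort (· ≤ ·)).imp (fun h => h)
      · rw [List.pairwise_map]
        exact (q.support.pairwise_sort (· ≤ ·)).imp (fun h => by simpa using h)
      · intro x hx y hy
        simp only [List.mem_map] at hx hy
        obtain ⟨a, -, rfl⟩ := hx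
        obtain ⟨b, -, rfl⟩ := hy
        rw [Fin.le_def]; simp; omega
    rw [← (List.toFinset_sort (· ≤ ·) hnd).2 hp]
    congr 1
    ext x
    rw [Finsupp.support_embDomain]
    obtain ⟨s, rfl⟩ := finSumFinEquiv.surjective x
    rcases s with a | a
    · have : ∀ b : Fin n, Fin.natAdd m b ≠ Fin.castAdd n a := fun b hb => by
        have := congrArg Fin.val hb
        simp at this; omega
      simp [Finsupp.sumElim, -finSumFinEquiv_apply_left, -finSumFinEquiv_apply_right]
      simp [this]
    · have : ∀ b : Fin m, Fin.castAdd n b ≠ Fin.natAdd m a := fun b hb => by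
        have := congrArg Fin.val hb
        simp at this; omega
      simp [Finsupp.sumElim, -finSumFinEquiv_apply_left, -finSumFinEquiv_apply_right]
      simp [this]
  unfold parts
  rw [h, List.map_append, List.map_map, List.map_map]
  have key : ∀ s, ((p.sumElim q).embDomain finSumFinEquiv.toEmbedding) (finSumFinEquiv s) =
      (p.sumElim q) s := fun s => Finsupp.embDomain_apply_self finSumFinEquiv.toEmbedding _ s
  congr 2
  · funext i
    have := key (Sum.inl i)
    simp only [finSumFinEquiv_apply_left] at this
    simp [this]
  · funext i
    have := key (Sum.inr i)
    simp only [finSumFinEquiv_apply_right] at this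
    simp [this]

open Classical in
theorem sum_antidiagonal_append {A : Type*} [AddCommMonoid A] (F : List ℕ+ → List ℕ+ → A)
    (α β : List ℕ+) :
    ∑ p ∈ Finset.HasAntidiagonal.antidiagonal (vec (α ++ β)), F (parts p.1) (parts p.2) =
      ∑ p ∈ Finset.HasAntidiagonal.antidiagonal (vec α), ∑ q ∈ Finset.HasAntidiagonal.antidiagonal (vec β),
        F (parts p.1 ++ parts q.1) (parts p.2 ++ parts q.2) := by
  have h : parts (((vec α).sumElim (vec β)).embDomain finSumFinEquiv.toEmbedding) = α ++ β := by
    rw [parts_sumElim, parts_vec, parts_vec]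
  rw [← h, ← sum_antidiagonal_eq, ← Finsupp.image_prodMap_embDomain_antidiagonal,
    Finset.sum_image
      ((Finsupp.embDomain_injective _).prodMap (Finsupp.embDomain_injective _)).injOn,
    ← Finsupp.image_sumElim_product_antidiagonal, Finset.sum_image, Finset.sum_product]
  · simp [parts_sumElim]
  · rintro ⟨⟨a, b⟩, c, d⟩ - ⟨⟨a', b'⟩, c', d'⟩ - h
    simp only [Prod.mk.injEq] at h
    obtain ⟨h1, h2⟩ := h
    have e1 : a = a' ∧ c = c' := ⟨by ext i; simpa using DFunLike.congr_fun h1 (Sum.inl i),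
      by ext i; simpa using DFunLike.congr_fun h1 (Sum.inr i)⟩
    have e2 : b = b' ∧ d = d' := ⟨by ext i; simpa using DFunLike.congr_fun h2 (Sum.inl i),
      by ext i; simpa using DFunLike.congr_fun h2 (Sum.inr i)⟩
    simp [e1, e2]

theorem finite_sum_eq (n : ℕ) :
    {α : List ℕ+ | (α.map (fun a : ℕ+ => (a : ℕ))).sum = n}.Finite := by
  refine Set.Finite.of_finite_image (f := fun α => α.map (fun a : ℕ+ => (a : ℕ))) ?_
    ((List.map_injective_iff.2 PNat.coe_injective).injOn)
  refine (Set.finite_range (fun c : Composition n => c.blocks)).subset ?_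
  rintro _ ⟨α, hα, rfl⟩
  refine ⟨⟨α.map (fun a : ℕ+ => (a : ℕ)), ?_, hα⟩, rfl⟩
  intro i hi
  simp only [List.mem_map] at hi
  obtain ⟨a, -, rfl⟩ := hi
  exact a.pos

theorem finite_sum_le (d : ℕ) :
    {α : List ℕ+ | (α.map (fun a : ℕ+ => (a : ℕ))).sum ≤ d}.Finite := by
  refine ((Set.finite_Iic d).biUnion fun n _ => finite_sum_eq n).subset ?_
  intro α hα
  simp only [Set.mem_iUnion]
  exact ⟨_, hα, rfl⟩

end Parts

section QSym

variable (k : Type u) [Field k]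

/-- The algebra `QSym` of quasi-symmetric functions in the ordered alphabet `x_0 < x_1 < ⋯`:
the power series of bounded degree in which the coefficients of `x_{i₁}^{a₁} ⋯ x_{iₖ}^{aₖ}`
and `x_{j₁}^{a₁} ⋯ x_{jₖ}^{aₖ}` agree whenever `i₁ < ⋯ < iₖ` and `j₁ < ⋯ < jₖ`. The theorem
`toSubmodule_eq_span` below identifies it with the span of the monomial quasi-symmetric
functions. -/
def QSym : Subalgebra k (MvPowerSeries ℕ k) where
  carrier := {f | (∃ d : ℕ, ∀ e, MvPowerSeries.coeff e f ≠ 0 → e.degree ≤ d) ∧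
    ∀ e e' : ℕ →₀ ℕ, parts e = parts e' → MvPowerSeries.coeff e f = MvPowerSeries.coeff e' f}
  mul_mem' := by
    classical
    rintro f g ⟨⟨d, hd⟩, hf⟩ ⟨⟨d', hd'⟩, hg⟩
    refine ⟨⟨d + d', fun e he => ?_⟩, fun e e' h => ?_⟩
    · rw [MvPowerSeries.coeff_mul] at he
      obtain ⟨p, hp, hne⟩ := Finset.exists_ne_zero_of_sum_ne_zero he
      rw [Finset.HasAntidiagonal.mem_antidiagonal] at hp
      rw [← hp, map_add]
      exact add_le_add (hd _ (left_ne_zero_of_mul hne)) (hd' _ (right_ne_zero_of_mul hne))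
    · rw [MvPowerSeries.coeff_mul, MvPowerSeries.coeff_mul]
      have key : ∀ e : ℕ →₀ ℕ, ∑ p ∈ Finset.HasAntidiagonal.antidiagonal e,
          MvPowerSeries.coeff p.1 f * MvPowerSeries.coeff p.2 g =
          ∑ p ∈ Finset.HasAntidiagonal.antidiagonal e,
          MvPowerSeries.coeff (std (parts p.1)) f * MvPowerSeries.coeff (std (parts p.2)) g :=
        fun e => Finset.sum_congr rfl fun p _ => by
          rw [hf p.1 (std (parts p.1)) (parts_std _).symm,
            hg p.2 (std (parts p.2)) (parts_std _).symm]
      have key2 := sum_antidiagonal_eq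
        (fun α β => MvPowerSeries.coeff (std α) f * MvPowerSeries.coeff (std β) g) (L := ℕ)
      rw [key, key]
      convert (key2 e).trans ((by rw [h]) : _ = _) using 1
      convert key2 e'
  add_mem' := by
    rintro f g ⟨⟨d, hd⟩, hf⟩ ⟨⟨d', hd'⟩, hg⟩
    refine ⟨⟨max d d', fun e he => ?_⟩, fun e e' h => ?_⟩
    · rw [map_add] at he
      by_cases h : MvPowerSeries.coeff e f = 0
      · rw [h, zero_add] at he
        exact (hd' e he).trans (le_max_right _ _)
      · exact (hd e h).trans (le_max_left _ _)
    · rw [map_add, map_add, hf e e' h, hg e e' h]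
  algebraMap_mem' := by
    classical
    intro r
    have h0 : ∀ e : ℕ →₀ ℕ, parts e = [] ↔ e = 0 := by
      intro e
      simp only [parts, List.map_eq_nil_iff]
      rw [← List.length_eq_zero_iff, Finset.length_sort, Finset.card_eq_zero,
        Finsupp.support_eq_empty]
    refine ⟨⟨0, fun e he => ?_⟩, fun e e' h => ?_⟩
    · rw [MvPowerSeries.algebraMap_apply, MvPowerSeries.coeff_C] at he
      have : e = 0 := by by_contra h; simp [h] at he
      simp [this]
    · have h1 : e = 0 ↔ e' = 0 := by rw [← h0, ← h0, h]
      simp only [MvPowerSeries.algebraMap_apply, MvPowerSeries.coeff_C, h1]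

variable {k}

theorem coeff_congr (f : QSym k) {e e' : ℕ →₀ ℕ} (h : parts e = parts e') :
    MvPowerSeries.coeff e (f : MvPowerSeries ℕ k) = MvPowerSeries.coeff e' f.1 :=
  f.2.2 e e' h

variable (k) in
/-- A quasi-symmetric function is determined by its finitely many nonzero coefficients, indexed by
compositions. -/
def coords : QSym k ≃ₗ[k] (List ℕ+ →₀ k) where
  toFun f := Finsupp.ofSupportFinite (fun α => MvPowerSeries.coeff (std α) f.1) (by
    obtain ⟨d, hd⟩ := f.2.1
    refine (finite_sum_le d).subset fun α hα => ?_
    have := hd _ hα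
    rwa [degree_eq, parts_std] at this)
  map_add' f g := by ext α; exact map_add (MvPowerSeries.coeff (std α)) f.1 g.1
  map_smul' r f := by ext α; exact map_smul (MvPowerSeries.coeff (std α)) r f.1
  invFun a := ⟨fun e => a (parts e), by
    refine ⟨⟨a.support.sup fun α => (α.map (fun a : ℕ+ => (a : ℕ))).sum, fun e he => ?_⟩,
      fun e e' h => ?_⟩
    · rw [degree_eq]
      exact Finset.le_sup (f := fun α : List ℕ+ => (α.map (fun a : ℕ+ => (a : ℕ))).sum)
        (Finsupp.mem_support_iff.2 he)
    · change a (parts e) = a (parts e')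
      rw [h]⟩
  left_inv f := by
    apply Subtype.ext
    funext e
    change MvPowerSeries.coeff (std (parts e)) f.1 = MvPowerSeries.coeff e f.1
    exact coeff_congr f (parts_std _)
  right_inv a := by
    ext α
    change a (parts (std α)) = a α
    rw [parts_std]

theorem coords_apply (f : QSym k) (α : List ℕ+) :
    coords k f α = MvPowerSeries.coeff (std α) f.1 := rfl

variable (k) in
/-- The monomial quasi-symmetric function
`M_α = ∑_{i₁ < ⋯ < iₖ} x_{i₁}^{a₁} ⋯ x_{iₖ}^{aₖ}` for `α = [a₁, …, aₖ]`: the power series in which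
a monomial has coefficient `1` if its composition is `α` and `0` otherwise. -/
def M (α : List ℕ+) : QSym k :=
  ⟨fun e => open Classical in if parts e = α then 1 else 0, by
    have : (fun e => open Classical in if parts e = α then (1 : k) else 0) =
        ((coords k).symm (Finsupp.single α 1)).1 := by
      classical
      funext e
      change _ = (Finsupp.single α (1 : k)) (parts e)
      simp [Finsupp.single_apply, eq_comm]
    rw [this]
    exact Subtype.prop _⟩

variable (k) in
/-- The basis of monomial quasi-symmetric functions. -/
def basisM : Module.Basis (List ℕ+) k (QSym k) := .ofRepr (coords k)

@[simp]
theorem basisM_apply (α : List ℕ+) : basisM k α = M k α := by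
  classical
  apply Subtype.ext
  funext e
  change (Finsupp.single α (1 : k)) (parts e) = if parts e = α then (1 : k) else 0
  simp [Finsupp.single_apply, eq_comm]

@[simp]
theorem coords_M (α : List ℕ+) : coords k (M k α) = Finsupp.single α 1 := by
  rw [← basisM_apply]
  exact (basisM k).repr_self α

theorem toSubmodule_eq_span :
    Subalgebra.toSubmodule (QSym k) =
      Submodule.span k (Set.range fun α => (M k α : MvPowerSeries ℕ k)) := by
  have h := congrArg (Submodule.map (Subalgebra.toSubmodule (QSym k)).subtype)
    (basisM k).span_eq
  rw [Submodule.map_span, ← Set.range_comp] at h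
  rw [Submodule.map_top, Submodule.range_subtype] at h
  rw [← h]
  congr 2
  funext α
  simp

theorem M_nil : M k [] = 1 := by
  classical
  have h0 : ∀ e : ℕ →₀ ℕ, parts e = [] ↔ e = 0 := by
    intro e
    simp only [parts, List.map_eq_nil_iff]
    rw [← List.length_eq_zero_iff, Finset.length_sort, Finset.card_eq_zero,
      Finsupp.support_eq_empty]
  apply Subtype.ext
  ext e
  change (if parts e = [] then (1 : k) else 0) = MvPowerSeries.coeff e 1
  rw [MvPowerSeries.coeff_one]
  simp [h0]

open Classical in
theorem coords_mul (f g : QSym k) (α : List ℕ+) :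
    coords k (f * g) α = ∑ p ∈ Finset.HasAntidiagonal.antidiagonal (vec α),
      coords k f (parts p.1) * coords k g (parts p.2) := by
  have h := sum_antidiagonal_eq (fun α β => coords k f α * coords k g β) (std α)
  rw [parts_std] at h
  rw [← h, coords_apply]
  change MvPowerSeries.coeff (std α) (f.1 * g.1) = _
  rw [MvPowerSeries.coeff_mul]
  refine Finset.sum_congr ?_ fun p _ => ?_
  · congr!
  rw [coords_apply, coords_apply]
  congr 1 <;> exact coeff_congr _ (parts_std _).symm

variable (k) in
/-- The coproduct `Δ(M_α) = ∑_{α = βγ} M_β ⊗ M_γ`, the sum running over all ways of writing `α` as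
a concatenation. -/
def comulMap : QSym k →ₗ[k] QSym k ⊗[k] QSym k :=
  (basisM k).constr k fun α =>
    ∑ i ∈ Finset.range (α.length + 1), M k (α.take i) ⊗ₜ[k] M k (α.drop i)

theorem comulMap_M (α : List ℕ+) : comulMap k (M k α) =
    ∑ i ∈ Finset.range (α.length + 1), M k (α.take i) ⊗ₜ[k] M k (α.drop i) := by
  rw [← basisM_apply, comulMap, Module.Basis.constr_basis]

variable (k) in
/-- The counit: projection onto the component of degree `0`, that is, the constant coefficient. -/
def counitMap : QSym k →ₗ[k] k := (MvPowerSeries.coeff 0).comp (QSym k).val.toLinearMap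

theorem counitMap_apply (f : QSym k) : counitMap k f = coords k f [] := by
  refine coeff_congr f ?_
  rw [parts_std]
  simp [parts]

theorem counitMap_M (α : List ℕ+) [Decidable (α = [])] :
    counitMap k (M k α) = if α = [] then 1 else 0 := by
  classical
  rw [counitMap_apply, coords_M, Finsupp.single_apply]

variable (k) in
/-- The coefficient of `M_α ⊗ M_β` in an element of `QSym ⊗ QSym`. -/
def coords₂ (α β : List ℕ+) : QSym k ⊗[k] QSym k →ₗ[k] k :=
  LinearMap.mul' k k ∘ₗ TensorProduct.map ((Finsupp.lapply α).comp (coords k).toLinearMap)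
    ((Finsupp.lapply β).comp (coords k).toLinearMap)

@[simp]
theorem coords₂_tmul (α β : List ℕ+) (f g : QSym k) :
    coords₂ k α β (f ⊗ₜ g) = coords k f α * coords k g β := by
  simp [coords₂]

theorem ext₂ {x y : QSym k ⊗[k] QSym k} (h : ∀ α β, coords₂ k α β x = coords₂ k α β y) :
    x = y := by
  apply ((basisM k).tensorProduct (basisM k)).repr.injective
  ext ⟨α, β⟩
  have key : ∀ z : QSym k ⊗[k] QSym k,
      ((basisM k).tensorProduct (basisM k)).repr z (α, β) = coords₂ k α β z := by
    intro z
    induction z with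
    | zero => simp
    | add x y hx hy => rw [map_add, Finsupp.add_apply, hx, hy, map_add]
    | tmul f g =>
      rw [Module.Basis.tensorProduct_repr_tmul_apply, coords₂_tmul, smul_eq_mul, mul_comm]
      rfl
  rw [key, key, h]

theorem coords₂_comulMap (α β : List ℕ+) (f : QSym k) :
    coords₂ k α β (comulMap k f) = coords k f (α ++ β) := by
  classical
  have : coords₂ k α β ∘ₗ comulMap k = (Finsupp.lapply (α ++ β)).comp (coords k).toLinearMap := by
    refine (basisM k).ext fun γ => ?_
    simp only [LinearMap.comp_apply, basisM_apply, comulMap_M, map_sum, coords₂_tmul, coords_M,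
      LinearEquiv.coe_coe, Finsupp.lapply_apply, Finsupp.single_apply]
    by_cases h : γ = α ++ β
    · rw [Finset.sum_eq_single α.length]
      · simp [h]
      · intro i hi hne
        rw [Finset.mem_range] at hi
        have : γ.take i ≠ α := fun h' => hne (by
          rw [← h', List.length_take]; omega)
        simp [this]
      · intro hn
        exact absurd (Finset.mem_range.2 (by simp [h])) hn
    · rw [if_neg h]
      refine Finset.sum_eq_zero fun i _ => ?_
      by_cases h1 : γ.take i = α
      · by_cases h2 : γ.drop i = β
        · exact absurd (by rw [← h1, ← h2, List.take_append_drop]) h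
        · simp [h2]
      · simp [h1]
  exact LinearMap.congr_fun this f

open Classical in
theorem coords₂_mul (α β : List ℕ+) (x y : QSym k ⊗[k] QSym k) :
    coords₂ k α β (x * y) = ∑ p ∈ Finset.HasAntidiagonal.antidiagonal (vec α),
      ∑ q ∈ Finset.HasAntidiagonal.antidiagonal (vec β),
        coords₂ k (parts p.1) (parts q.1) x * coords₂ k (parts p.2) (parts q.2) y := by
  induction x with
  | zero => simp
  | add x x' hx hx' => simp only [add_mul, map_add, hx, hx', Finset.sum_add_distrib]
  | tmul f g =>
    induction y with
    | zero => simp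
    | add y y' hy hy' => simp only [mul_add, map_add, hy, hy', Finset.sum_add_distrib]
    | tmul f' g' =>
      rw [Algebra.TensorProduct.tmul_mul_tmul, coords₂_tmul, coords_mul, coords_mul,
        Finset.sum_mul_sum]
      refine Finset.sum_congr rfl fun p _ => Finset.sum_congr rfl fun q _ => ?_
      simp only [coords₂_tmul]
      ring

theorem comulMap_mul (f g : QSym k) : comulMap k (f * g) = comulMap k f * comulMap k g := by
  refine ext₂ fun α β => ?_
  rw [coords₂_comulMap, coords₂_mul, coords_mul]
  rw [sum_antidiagonal_append (fun α β => coords k f α * coords k g β)]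
  simp only [coords₂_comulMap]

theorem comulMap_one : comulMap k (1 : QSym k) = 1 := by
  rw [← M_nil, comulMap_M]
  simp [M_nil, Algebra.TensorProduct.one_def]

set_option synthInstance.maxHeartbeats 400000 in
theorem ext₃ {x y : QSym k ⊗[k] (QSym k ⊗[k] QSym k)}
    (h : ∀ α β γ, (LinearMap.mul' k k ∘ₗ TensorProduct.map
        ((Finsupp.lapply α).comp (coords k).toLinearMap) (coords₂ k β γ)) x =
      (LinearMap.mul' k k ∘ₗ TensorProduct.map
        ((Finsupp.lapply α).comp (coords k).toLinearMap) (coords₂ k β γ)) y) : x = y := by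
  let b := (basisM k).tensorProduct ((basisM k).tensorProduct (basisM k))
  apply b.repr.injective
  ext ⟨α, β, γ⟩
  have key : ∀ z, b.repr z (α, β, γ) = (LinearMap.mul' k k ∘ₗ TensorProduct.map
        ((Finsupp.lapply α).comp (coords k).toLinearMap) (coords₂ k β γ)) z := by
    intro z
    induction z with
    | zero => simp
    | add x y hx hy => rw [map_add, Finsupp.add_apply, hx, hy, map_add]
    | tmul f z =>
      induction z with
      | zero => simp
      | add x y hx hy => rw [TensorProduct.tmul_add, map_add, Finsupp.add_apply, hx, hy, map_add]
      | tmul g h =>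
        simp only [b, Module.Basis.tensorProduct_repr_tmul_apply, LinearMap.comp_apply,
          TensorProduct.map_tmul, LinearMap.mul'_apply, coords₂_tmul, smul_eq_mul]
        change (coords k h γ * coords k g β) * coords k f α = coords k f α * _
        ring
  rw [key, key, h]

set_option synthInstance.maxHeartbeats 400000 in
theorem comulMap_coassoc :
    TensorProduct.assoc k (QSym k) (QSym k) (QSym k) ∘ₗ (comulMap k).rTensor (QSym k) ∘ₗ
      comulMap k = (comulMap k).lTensor (QSym k) ∘ₗ comulMap k := by
  refine LinearMap.ext fun f => ext₃ fun α β γ => ?_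
  have h1 : ∀ z : QSym k ⊗[k] QSym k, (LinearMap.mul' k k ∘ₗ TensorProduct.map
        ((Finsupp.lapply α).comp (coords k).toLinearMap) (coords₂ k β γ))
        ((comulMap k).lTensor (QSym k) z) = coords₂ k α (β ++ γ) z := by
    intro z
    induction z with
    | zero => simp
    | add x y hx hy => simp only [map_add, hx, hy]
    | tmul f g => simp [coords₂_comulMap]
  have h2 : ∀ w : QSym k ⊗[k] QSym k, ∀ g : QSym k, (LinearMap.mul' k k ∘ₗ TensorProduct.map
        ((Finsupp.lapply α).comp (coords k).toLinearMap) (coords₂ k β γ))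
        (TensorProduct.assoc k (QSym k) (QSym k) (QSym k) (w ⊗ₜ g)) =
        coords₂ k α β w * coords k g γ := by
    intro w g
    induction w with
    | zero => simp
    | add x y hx hy => simp only [TensorProduct.add_tmul, map_add, hx, hy, add_mul]
    | tmul f h => simp [mul_assoc]
  have h3 : ∀ z : QSym k ⊗[k] QSym k, (LinearMap.mul' k k ∘ₗ TensorProduct.map
        ((Finsupp.lapply α).comp (coords k).toLinearMap) (coords₂ k β γ))
        (TensorProduct.assoc k (QSym k) (QSym k) (QSym k) ((comulMap k).rTensor (QSym k) z)) =
        coords₂ k (α ++ β) γ z := by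
    intro z
    induction z with
    | zero => simp
    | add x y hx hy => simp only [map_add, hx, hy]
    | tmul f g => rw [LinearMap.rTensor_tmul, h2, coords₂_comulMap, coords₂_tmul]
  have e1 := h1 (comulMap k f)
  have e3 := h3 (comulMap k f)
  rw [coords₂_comulMap] at e1 e3
  rw [List.append_assoc] at e3
  exact e3.trans e1.symm

instance instCoalgebra : Coalgebra k (QSym k) where
  comul := comulMap k
  counit := counitMap k
  coassoc := comulMap_coassoc
  rTensor_counit_comp_comul := by
    classical
    refine (basisM k).ext fun α => ?_
    simp only [LinearMap.comp_apply, basisM_apply, comulMap_M, map_sum, LinearMap.rTensor_tmul,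
      counitMap_M]
    rw [Finset.sum_eq_single 0]
    · simp
    · intro i hi h0
      rw [Finset.mem_range] at hi
      have : α.take i ≠ [] := by
        intro h
        have := congrArg List.length h
        simp at this
        rcases this with h | h
        · exact h0 h
        · simp [h] at hi; omega
      simp [this]
    · simp
  lTensor_counit_comp_comul := by
    classical
    refine (basisM k).ext fun α => ?_
    simp only [LinearMap.comp_apply, basisM_apply, comulMap_M, map_sum, LinearMap.lTensor_tmul,
      counitMap_M]
    rw [Finset.sum_eq_single α.length]
    · simp
    · intro i hi h0
      rw [Finset.mem_range] at hi
      have : α.drop i ≠ [] := by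
        intro h
        have := congrArg List.length h
        simp at this
        omega
      simp [this]
    · simp

instance instBialgebra : Bialgebra k (QSym k) :=
  Bialgebra.mk' k (QSym k)
    (by
      classical
      change counitMap k 1 = 1
      rw [← M_nil, counitMap_M]; simp)
    (by
      intro f g
      change MvPowerSeries.constantCoeff (f.1 * g.1) = _
      rw [map_mul]
      rfl)
    comulMap_one (comulMap_mul _ _)

theorem comul_M (α : List ℕ+) : Coalgebra.comul (R := k) (M k α) =
    ∑ i ∈ Finset.range (α.length + 1), M k (α.take i) ⊗ₜ[k] M k (α.drop i) :=
  comulMap_M α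

variable (k) in
/-- The values `S(M_α)` of the antipode, computed recursively from
`∑_{α = βγ} S(M_β) M_γ = 0` for nonempty `α`. -/
def antipodeM (α : List ℕ+) : QSym k :=
  if α = [] then 1
  else - ∑ i : Fin α.length, antipodeM (α.take i) * M k (α.drop i)
termination_by α.length
decreasing_by simp

variable (k) in
/-- The recursion dual to `antipodeM`, giving a right convolution inverse of the identity; it
defines the same elements. -/
def antipodeM' (α : List ℕ+) : QSym k :=
  if α = [] then 1
  else - ∑ i : Fin α.length, M k (α.take (i + 1)) * antipodeM' (α.drop (i + 1))
termination_by α.length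
decreasing_by
  have := i.isLt
  rw [List.length_drop]
  omega

variable (k) in
/-- The antipode of `QSym`. -/
def antipodeMap : QSym k →ₗ[k] QSym k := (basisM k).constr k (antipodeM k)

theorem antipodeMap_M (α : List ℕ+) : antipodeMap k (M k α) = antipodeM k α := by
  rw [← basisM_apply, antipodeMap, Module.Basis.constr_basis]

theorem antipode_left :
    LinearMap.mul' k (QSym k) ∘ₗ (antipodeMap k).rTensor (QSym k) ∘ₗ Coalgebra.comul =
      Algebra.linearMap k (QSym k) ∘ₗ Coalgebra.counit := by
  classical
  refine (basisM k).ext fun α => ?_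
  simp only [LinearMap.comp_apply, basisM_apply, comul_M, map_sum, LinearMap.rTensor_tmul,
    LinearMap.mul'_apply, antipodeMap_M]
  change _ = algebraMap k (QSym k) (counitMap k (M k α))
  rw [counitMap_M, Finset.sum_range_succ]
  by_cases h : α = []
  · subst h
    simp [antipodeM, M_nil]
  · rw [if_neg h, map_zero]
    conv_lhs => arg 2; rw [List.take_length, List.drop_length, M_nil, mul_one, antipodeM, if_neg h]
    rw [Finset.sum_range, add_neg_cancel]

theorem antipode_right' :
    LinearMap.mul' k (QSym k) ∘ₗ ((basisM k).constr k (antipodeM' k)).lTensor (QSym k) ∘ₗ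
      Coalgebra.comul = Algebra.linearMap k (QSym k) ∘ₗ Coalgebra.counit := by
  classical
  refine (basisM k).ext fun α => ?_
  have hc : ∀ β, (basisM k).constr k (antipodeM' k) (M k β) = antipodeM' k β := fun β => by
    rw [← basisM_apply, Module.Basis.constr_basis]
  simp only [LinearMap.comp_apply, basisM_apply, comul_M, map_sum, LinearMap.lTensor_tmul,
    LinearMap.mul'_apply, hc]
  change _ = algebraMap k (QSym k) (counitMap k (M k α))
  rw [counitMap_M, Finset.sum_range_succ']
  by_cases h : α = []
  · subst h
    simp [antipodeM', M_nil]
  · rw [if_neg h, map_zero]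
    conv_lhs => arg 2; rw [List.take_zero, List.drop_zero, M_nil, one_mul, antipodeM', if_neg h]
    rw [Finset.sum_range, add_neg_cancel]

theorem antipode_right :
    LinearMap.mul' k (QSym k) ∘ₗ (antipodeMap k).lTensor (QSym k) ∘ₗ Coalgebra.comul =
      Algebra.linearMap k (QSym k) ∘ₗ Coalgebra.counit := by
  have h : WithConv.toConv (antipodeMap k) =
      WithConv.toConv ((basisM k).constr k (antipodeM' k)) := by
    refine left_inv_eq_right_inv (a := WithConv.toConv (LinearMap.id (R := k) (M := QSym k))) ?_ ?_
    · exact congrArg WithConv.toConv antipode_left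
    · exact congrArg WithConv.toConv antipode_right'
  have h' : antipodeMap k = (basisM k).constr k (antipodeM' k) := congrArg WithConv.ofConv h
  rw [h']
  exact antipode_right'

instance instHopfAlgebra : HopfAlgebra k (QSym k) where
  antipode := antipodeMap k
  mul_antipode_rTensor_comul := antipode_left
  mul_antipode_lTensor_comul := antipode_right

variable (k) in
/-- The homogeneous component of degree `n`, spanned by the `M_α` with `α` a composition
of `n`. -/
def grade (n : ℕ) : Submodule k (QSym k) :=
  Submodule.span k (M k '' {α | (α.map (fun a : ℕ+ => (a : ℕ))).sum = n})

theorem M_mem_grade (α : List ℕ+) : M k α ∈ grade k (α.map (fun a : ℕ+ => (a : ℕ))).sum :=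
  Submodule.subset_span ⟨α, rfl, rfl⟩

theorem mem_grade {n : ℕ} {f : QSym k} :
    f ∈ grade k n ↔ ∀ α, coords k f α ≠ 0 → (α.map (fun a : ℕ+ => (a : ℕ))).sum = n := by
  have : M k = basisM k := by funext α; simp
  rw [grade, this, Module.Basis.mem_span_image]
  constructor
  · intro h α hα
    exact h (Finset.mem_coe.2 (Finsupp.mem_support_iff.2 hα))
  · intro h α hα
    exact h α (Finsupp.mem_support_iff.1 (Finset.mem_coe.1 hα))

instance instGradedMonoid : SetLike.GradedMonoid (grade k) where
  one_mem := by
    rw [← M_nil]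
    exact M_mem_grade []
  mul_mem := by
    classical
    intro m n f g hf hg
    rw [mem_grade] at *
    intro α hα
    rw [coords_mul] at hα
    obtain ⟨p, hp, hne⟩ := Finset.exists_ne_zero_of_sum_ne_zero hα
    have h1 := hf _ (left_ne_zero_of_mul hne)
    have h2 := hg _ (right_ne_zero_of_mul hne)
    rw [← degree_eq] at h1 h2
    rw [Finset.HasAntidiagonal.mem_antidiagonal] at hp
    rw [← parts_vec α, ← degree_eq, ← hp, map_add, h1, h2]

variable (k) in
/-- Splitting a quasi-symmetric function into its homogeneous components. -/
def decomposeMap : QSym k →ₗ[k] DirectSum ℕ fun n => grade k n :=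
  (basisM k).constr k fun α => DirectSum.lof k ℕ (fun n => grade k n) _ ⟨M k α, M_mem_grade α⟩

theorem decomposeMap_M (α : List ℕ+) : decomposeMap k (M k α) =
    DirectSum.lof k ℕ (fun n => grade k n) _ ⟨M k α, M_mem_grade α⟩ := by
  have h := (basisM k).constr_basis k (fun α =>
    DirectSum.lof k ℕ (fun n => grade k n) _ ⟨M k α, M_mem_grade α⟩) α
  rwa [basisM_apply] at h

instance instDecomposition : DirectSum.Decomposition (grade k) :=
  DirectSum.Decomposition.ofLinearMap (grade k) (decomposeMap k)
    (by
      refine (basisM k).ext fun α => ?_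
      simp [decomposeMap_M])
    (by
      refine DirectSum.linearMap_ext k fun n => LinearMap.ext fun ⟨x, hx⟩ => ?_
      simp only [LinearMap.comp_apply, DirectSum.coeLinearMap_lof, LinearMap.id_apply]
      induction hx using Submodule.span_induction with
      | mem x h =>
        obtain ⟨α, rfl, rfl⟩ := h
        exact decomposeMap_M α
      | zero => exact (map_zero _).trans (map_zero (DirectSum.lof k ℕ (fun n => grade k n) n)).symm
      | add x y hx hy h1 h2 =>
        rw [map_add, h1, h2, ← map_add]
        rfl
      | smul r x hx h =>
        rw [map_smul, h, ← map_smul]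
        rfl)

instance instGradedAlgebra : GradedAlgebra (grade k) where

instance finite_grade (n : ℕ) : FiniteDimensional k (grade k n) :=
  FiniteDimensional.span_of_finite k ((finite_sum_eq n).image _)

theorem grade_zero : grade k 0 = 1 := by
  have : {α : List ℕ+ | (α.map (fun a : ℕ+ => (a : ℕ))).sum = 0} = {[]} := by
    ext α
    rcases α with _ | ⟨a, α⟩
    · simp
    · have := a.pos
      simp
  rw [grade, this, Set.image_singleton, M_nil, Submodule.one_eq_span]

theorem sum_take_add_drop (α : List ℕ+) (i : ℕ) :
    ((α.take i).map (fun a : ℕ+ => (a : ℕ))).sum + ((α.drop i).map (fun a : ℕ+ => (a : ℕ))).sum =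
      (α.map (fun a : ℕ+ => (a : ℕ))).sum := by
  rw [← List.sum_append, ← List.map_append, List.take_append_drop]

theorem antipodeM_mem (α : List ℕ+) :
    antipodeM k α ∈ grade k (α.map (fun a : ℕ+ => (a : ℕ))).sum := by
  rw [antipodeM]
  split_ifs with h
  · subst h
    exact SetLike.GradedMonoid.toGradedOne.one_mem
  · refine neg_mem (sum_mem fun i _ => ?_)
    rw [← sum_take_add_drop α i]
    exact SetLike.GradedMul.mul_mem (antipodeM_mem _) (M_mem_grade _)
termination_by α.length
decreasing_by simp

theorem parts_single (n : ℕ) : parts (Finsupp.single (0 : ℕ) n) =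
    if 0 < n then [n.toPNat'] else [] := by
  split_ifs with h
  · have hs : (Finsupp.single (0 : ℕ) n).support = {0} :=
      Finsupp.support_single 0 h.ne'
    rw [parts, hs, Finset.sort_singleton, List.map_singleton, Finsupp.single_eq_same]
  · have : n = 0 := by omega
    simp [this, parts]

variable (k) in
/-- The result of substituting `x_0 = X` and `x_i = 0` for `i ≠ 0` in a quasi-symmetric function,
as a linear map; it is a polynomial because degrees are bounded. -/
def toPolyLin : QSym k →ₗ[k] Polynomial k where
  toFun f := ⟨.ofCoeff (Finsupp.ofSupportFinite
    (fun n => MvPowerSeries.coeff (Finsupp.single 0 n) f.1) (by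
      obtain ⟨d, hd⟩ := f.2.1
      refine (Set.finite_Iic d).subset fun n hn => ?_
      simpa using hd _ hn))⟩
  map_add' f g := Polynomial.ext fun n => by
    rw [Polynomial.coeff_add]
    exact map_add (MvPowerSeries.coeff (Finsupp.single 0 n)) f.1 g.1
  map_smul' r f := Polynomial.ext fun n => by
    rw [Polynomial.coeff_smul]
    exact map_smul (MvPowerSeries.coeff (Finsupp.single 0 n)) r f.1

theorem coeff_toPolyLin (f : QSym k) (n : ℕ) :
    (toPolyLin k f).coeff n = MvPowerSeries.coeff (Finsupp.single 0 n) f.1 := rfl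

variable (k) in
/-- The substitution `x_0 = X`, `x_i = 0` for `i ≠ 0`, as a morphism of algebras. -/
def toPoly : QSym k →ₐ[k] Polynomial k :=
  AlgHom.ofLinearMap (toPolyLin k)
    (by
      classical
      ext n
      rw [coeff_toPolyLin, Polynomial.coeff_one]
      change MvPowerSeries.coeff _ 1 = _
      rw [MvPowerSeries.coeff_one]
      simp)
    (by
      classical
      intro f g
      ext n
      rw [coeff_toPolyLin, Polynomial.coeff_mul]
      change MvPowerSeries.coeff _ (f.1 * g.1) = _
      rw [MvPowerSeries.coeff_mul, Finsupp.antidiagonal_single, Finset.sum_map]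
      rfl)

variable (k) in
/-- The canonical character `ζ_Q` of `QSym`: the morphism of algebras that sets the first variable
to `1` and all other variables to `0`. -/
def zetaQ : QSym k →ₐ[k] k := (Polynomial.aeval (1 : k)).comp (toPoly k)

theorem zetaQ_M (α : List ℕ+) : zetaQ k (M k α) = if α.length ≤ 1 then 1 else 0 := by
  classical
  have hc : ∀ n, (toPoly k (M k α)).coeff n =
      if parts (Finsupp.single (0 : ℕ) n) = α then 1 else 0 := fun n => rfl
  have hp : toPoly k (M k α) =
      if α.length ≤ 1 then Polynomial.X ^ (α.map (fun a : ℕ+ => (a : ℕ))).sum else 0 := by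
    ext n
    rw [hc, parts_single]
    rcases α with _ | ⟨a, _ | ⟨b, α⟩⟩
    · by_cases h : 0 < n
      · simp [h, Polynomial.coeff_one, h.ne']
      · have : n = 0 := by omega
        simp [this]
    · by_cases h : 0 < n
      · simp [h, Polynomial.coeff_X_pow, ← PNat.coe_inj, Nat.toPNat'_coe]
      · have : n = 0 := by omega
        have := a.pos.ne
        simp_all [Polynomial.coeff_X_pow]
    · by_cases h : 0 < n <;> simp [h]
  rw [zetaQ, AlgHom.comp_apply, hp]
  split_ifs <;> simp

end QSym

end QuasiSym

/-- A combinatorial Hopf algebra over a field `k`: a graded connected Hopf algebra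
`H = ⨁ₙ Hₙ` with finite-dimensional homogeneous components, together with a character, i.e. a
morphism of algebras `ζ : H → k`. -/
structure CombHopfAlg (k : Type u) [Field k] where
  /-- The underlying space of `H`. -/
  carrier : Type v
  [ring : Ring carrier]
  [hopf : HopfAlgebra k carrier]
  /-- The homogeneous components. -/
  grading : ℕ → Submodule k carrier
  /-- `H` is the direct sum of its components, the unit has degree `0` and the product preserves
  degrees. -/
  [graded : GradedAlgebra grading]
  comul_mem : ∀ n, ∀ x ∈ grading n, Coalgebra.comul (R := k) x ∈
    ⨆ p ∈ Finset.HasAntidiagonal.antidiagonal n,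
      LinearMap.range (TensorProduct.map (grading p.1).subtype (grading p.2).subtype)
  counit_eq_zero : ∀ n, n ≠ 0 → ∀ x ∈ grading n, Coalgebra.counit (R := k) x = 0
  antipode_mem : ∀ n, ∀ x ∈ grading n, HopfAlgebra.antipode k x ∈ grading n
  /-- Connectedness: the component of degree `0` is `k · 1`. -/
  connected : grading 0 = 1
  finite : ∀ n, FiniteDimensional k (grading n)
  /-- The character. -/
  zeta : carrier →ₐ[k] k

namespace CombHopfAlg

attribute [instance] ring hopf graded

variable {k : Type u} [Field k]

/-- A morphism of combinatorial Hopf algebras: a morphism of graded Hopf algebras `α : H → K` with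
`ζ_K ∘ α = ζ_H`. As in Mathlib, a morphism of Hopf algebras is a morphism of bialgebras; it
commutes with the antipodes automatically. -/
@[ext]
structure Hom (H : CombHopfAlg.{u, v} k) (K : CombHopfAlg.{u, w} k) where
  /-- The underlying morphism of bialgebras. -/
  toBialgHom : H.carrier →ₐc[k] K.carrier
  map_grading : ∀ n, ∀ x ∈ H.grading n, toBialgHom x ∈ K.grading n
  zeta_map : ∀ x, K.zeta (toBialgHom x) = H.zeta x

/-- The image of a morphism, as a subspace of the target. -/
def Hom.image {H : CombHopfAlg.{u, v} k} {K : CombHopfAlg.{u, w} k} (f : H.Hom K) :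
    Submodule k K.carrier :=
  LinearMap.range (f.toBialgHom : H.carrier →ₗ[k] K.carrier)

/-- The category of combinatorial Hopf algebras over `k`. -/
instance category : CategoryTheory.Category (CombHopfAlg.{u, v} k) where
  Hom H K := Hom H K
  id H := ⟨BialgHom.id k H.carrier, fun _ _ hx => hx, fun _ => rfl⟩
  comp f g := ⟨g.toBialgHom.comp f.toBialgHom,
    fun n x hx => g.map_grading n _ (f.map_grading n x hx),
    fun x => (g.zeta_map _).trans (f.zeta_map x)⟩

section

variable (H : CombHopfAlg.{u, v} k)

/-- The canonical involution `h ↦ h̄`, with `h̄ = (-1)ⁿ h` for `h` homogeneous of degree `n`. -/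
def bar : H.carrier →ₗ[k] H.carrier :=
  DirectSum.toModule k ℕ H.carrier (fun n => (-1 : k) ^ n • (H.grading n).subtype) ∘ₗ
    (DirectSum.decomposeLinearEquiv H.grading).toLinearMap

theorem bar_of_mem {n : ℕ} {x : H.carrier} (hx : x ∈ H.grading n) :
    H.bar x = (-1 : k) ^ n • x := by
  simp only [bar, LinearMap.comp_apply, LinearEquiv.coe_coe, DirectSum.decomposeLinearEquiv_apply]
  rw [DirectSum.decompose_of_mem H.grading hx]
  exact DirectSum.toModule_lof (M := fun n => H.grading n) k n ⟨x, hx⟩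

/-- The functional `ζ̄`, given by `ζ̄(h) = ζ(h̄)`. -/
def zetaBar : H.carrier →ₗ[k] k := H.zeta.toLinearMap ∘ₗ H.bar

/-- The convolution inverse `ζ⁻¹ = ζ ∘ S` of the character `ζ`, where `S` is the antipode. -/
def zetaInv : H.carrier →ₗ[k] k := H.zeta.toLinearMap ∘ₗ HopfAlgebra.antipode k

/-- The character is even: `ζ̄ = ζ`. -/
def IsEven : Prop := H.zetaBar = H.zeta.toLinearMap

/-- The character is odd: `ζ̄ = ζ⁻¹`. -/
def IsOdd : Prop := H.zetaBar = H.zetaInv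

variable {H} in
/-- `C` is a graded subcoalgebra: it contains the homogeneous components of its elements, and
`Δ(C) ⊆ C ⊗ C`. -/
structure IsGradedSubcoalgebra (C : Submodule k H.carrier) : Prop where
  homogeneous : ∀ h ∈ C, ∀ n, (DirectSum.decompose H.grading h n : H.carrier) ∈ C
  comul_mem : ∀ h ∈ C, Coalgebra.comul (R := k) h ∈
    LinearMap.range (TensorProduct.map C.subtype C.subtype)

/-- `S(φ, ψ)`, the largest graded subcoalgebra on which the functionals `φ` and `ψ` agree: the sum
of all of them, which is again one by `isGreatest_eqSubcoalgebra`. -/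
def eqSubcoalgebra (φ ψ : H.carrier →ₗ[k] k) : Submodule k H.carrier :=
  sSup {C | IsGradedSubcoalgebra C ∧ ∀ h ∈ C, φ h = ψ h}

theorem isGreatest_eqSubcoalgebra (φ ψ : H.carrier →ₗ[k] k) :
    IsGreatest {C | IsGradedSubcoalgebra C ∧ ∀ h ∈ C, φ h = ψ h} (H.eqSubcoalgebra φ ψ) := by
  refine ⟨⟨⟨?_, ?_⟩, ?_⟩, fun C hC => le_sSup hC⟩
  · intro h hh n
    have : H.eqSubcoalgebra φ ψ ≤
        (H.eqSubcoalgebra φ ψ).comap (GradedAlgebra.proj H.grading n) :=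
      sSup_le fun C hC x hx => (le_sSup hC : C ≤ H.eqSubcoalgebra φ ψ) (hC.1.homogeneous x hx n)
    exact this hh
  · intro h hh
    have : H.eqSubcoalgebra φ ψ ≤ (LinearMap.range (TensorProduct.map
        (H.eqSubcoalgebra φ ψ).subtype (H.eqSubcoalgebra φ ψ).subtype)).comap
        (Coalgebra.comul (R := k)) := by
      refine sSup_le fun C hC x hx => ?_
      have hle : C ≤ H.eqSubcoalgebra φ ψ := le_sSup hC
      obtain ⟨y, hy⟩ := hC.1.comul_mem x hx
      refine ⟨TensorProduct.map (Submodule.inclusion hle) (Submodule.inclusion hle) y, ?_⟩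
      rw [← LinearMap.comp_apply, ← TensorProduct.map_comp]
      exact hy
    exact this hh
  · intro h hh
    have : H.eqSubcoalgebra φ ψ ≤ LinearMap.eqLocus φ ψ :=
      sSup_le fun C hC x hx => hC.2 x hx
    exact this hh

/-- The even subalgebra `S₊(H, ζ) = S(ζ̄, ζ)`. -/
def evenSubalgebra : Submodule k H.carrier := H.eqSubcoalgebra H.zetaBar H.zeta.toLinearMap

/-- The odd subalgebra `S₋(H, ζ) = S(ζ̄, ζ⁻¹)`. -/
def oddSubalgebra : Submodule k H.carrier := H.eqSubcoalgebra H.zetaBar H.zetaInv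

end

end CombHopfAlg

/-- The category of even combinatorial Hopf algebras: the full subcategory on the `(H, ζ)` with
`ζ` even. -/
abbrev EvenCombHopfAlg (k : Type u) [Field k] :=
  CategoryTheory.ObjectProperty.FullSubcategory
    (fun H : CombHopfAlg.{u, v} k => CombHopfAlg.IsEven H)

/-- The category of odd combinatorial Hopf algebras: the full subcategory on the `(H, ζ)` with
`ζ` odd. -/
abbrev OddCombHopfAlg (k : Type u) [Field k] :=
  CategoryTheory.ObjectProperty.FullSubcategory
    (fun H : CombHopfAlg.{u, v} k => CombHopfAlg.IsOdd H)

open QuasiSym in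
/-- The combinatorial Hopf algebra `(QSym, ζ_Q)`. -/
def qsymCHA (k : Type u) [Field k] : CombHopfAlg.{u, u} k where
  carrier := QSym k
  grading := QuasiSym.grade k
  comul_mem n x hx := by
    rw [QuasiSym.grade] at hx
    induction hx using Submodule.span_induction with
    | mem x h =>
      obtain ⟨α, hα, rfl⟩ := h
      rw [comul_M]
      refine sum_mem fun i _ => ?_
      refine Submodule.mem_iSup_of_mem (_, _) (Submodule.mem_iSup_of_mem
        (Finset.HasAntidiagonal.mem_antidiagonal.2 ((sum_take_add_drop α i).trans hα)) ?_)
      exact ⟨⟨_, M_mem_grade _⟩ ⊗ₜ ⟨_, M_mem_grade _⟩, rfl⟩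
    | zero => rw [map_zero]; exact zero_mem _
    | add x y _ _ h1 h2 => rw [map_add]; exact add_mem h1 h2
    | smul r x _ h => rw [map_smul]; exact Submodule.smul_mem _ r h
  counit_eq_zero n hn x hx := by
    by_contra h
    refine hn ((mem_grade.1 hx [] ?_).symm)
    rw [← counitMap_apply]
    exact h
  antipode_mem n x hx := by
    rw [QuasiSym.grade] at hx
    induction hx using Submodule.span_induction with
    | mem x h =>
      obtain ⟨α, hα, rfl⟩ := h
      have h := antipodeM_mem (k := k) α
      rw [hα, ← antipodeMap_M] at h
      exact h
    | zero => rw [map_zero]; exact zero_mem _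
    | add x y _ _ h1 h2 => rw [map_add]; exact add_mem h1 h2
    | smul r x _ h => rw [map_smul]; exact Submodule.smul_mem _ r h
  connected := grade_zero
  finite := finite_grade
  zeta := zetaQ k

/-- `Π₊`, the even subalgebra of `(QSym, ζ_Q)`. -/
def PiPlus (k : Type u) [Field k] : Submodule k (qsymCHA k).carrier :=
  (qsymCHA k).evenSubalgebra

/-- `Π₋`, the odd subalgebra of `(QSym, ζ_Q)`. -/
def PiMinus (k : Type u) [Field k] : Submodule k (qsymCHA k).carrier :=
  (qsymCHA k).oddSubalgebra

end

/-! Let ζ_n be the degree n part of ζ, and for a composition α = (a₁, …, aₖ) let ζ_α = ζ_{a₁} ⋯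
ζ_{aₖ} be the convolution product. The canonical morphism is Ψ(h) = ∑_α ζ_α(h) M_α, a finite sum
because ζ_α lives in degree |α| (`zetaConv_of_mem_ne`). Connectedness gives ζ_0 = ε, so zero parts
can be dropped, and multiplicativity of ζ gives ζ_n(xy) = ∑ ζ_p(x) ζ_q(y) over p + q = n. Hence
ζ_α(xy) expands exactly as the coefficient of M_α in a product of quasi-symmetric functions
(`zetaConv_mul`). The deconcatenation coproduct matches ζ_{αβ} = ζ_α ζ_β. On QSym itself ζ_α is the
coefficient of M_α (`zetaConv_qsymCHA`), and the ζ_α pull back along morphisms, so the coefficients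
of any morphism to QSym are forced (`hom_qsym_ext`).

The image of a morphism is a graded subcoalgebra, and ζ̄ and ζ⁻¹ pull back to ζ̄ and ζ⁻¹. If the
source is even or odd, the image therefore lies in Π₊ or Π₋ by maximality.

It remains to make Π₊ and Π₋ into objects. Let C be the largest graded subcoalgebra on which two
characters agree; this covers both cases, as ζ̄ and ζ⁻¹ are characters. Both k · 1 and C · C have
the same property, so they lie in C and C is a subalgebra. It is stable under the antipode by
induction on the degree (`antipode_mem_of_mem_grading`). Over a field the tensor powers of C embed
in those of the ambient algebra, so C inherits every axiom. Terminality follows: Ψ factors through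
C, and the injective inclusion carries uniqueness over from QSym. -/

noncomputable section

open scoped TensorProduct

/-! ### Preliminaries: graded maps, convolution of functionals on products, one-part compositions.
-/

namespace DirectSum

variable {ι k A B : Type*} [DecidableEq ι] [Semiring k] [AddCommMonoid A] [AddCommMonoid B]
  [Module k A] [Module k B] (𝒜 : ι → Submodule k A) (ℬ : ι → Submodule k B)
  [Decomposition 𝒜] [Decomposition ℬ]

/-- A degree-preserving linear map commutes with the projections to the components. -/
theorem decompose_map_of_mem (f : A →ₗ[k] B) (hf : ∀ n, ∀ x ∈ 𝒜 n, f x ∈ ℬ n) (x : A) (n : ι) :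
    (decompose ℬ (f x) n : B) = f (decompose 𝒜 x n : A) := by
  induction x using Decomposition.inductionOn 𝒜 with
  | zero => simp
  | homogeneous x =>
    rename_i m
    by_cases h : m = n
    · subst h
      rw [decompose_of_mem_same _ (hf _ _ x.2), decompose_of_mem_same _ x.2]
    · rw [decompose_of_mem_ne _ (hf _ _ x.2) h, decompose_of_mem_ne _ x.2 h, map_zero]
  | add x y hx hy => simp [decompose_add, hx, hy]

end DirectSum

namespace LinearMap

variable {k A : Type*} [Field k] [Ring A] [Bialgebra k A]

/-- If two functionals factor multiplicatively through finite families of functionals, then so does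
their convolution product. -/
theorem convMul_apply_mul_of_forall {ι κ : Type*} (s : Finset ι) (t : Finset κ)
    {a b : WithConv (A →ₗ[k] k)} {a₁ a₂ : ι → WithConv (A →ₗ[k] k)}
    {b₁ b₂ : κ → WithConv (A →ₗ[k] k)}
    (ha : ∀ x y, a (x * y) = ∑ i ∈ s, a₁ i x * a₂ i y)
    (hb : ∀ x y, b (x * y) = ∑ j ∈ t, b₁ j x * b₂ j y) (x y : A) :
    (a * b) (x * y) = ∑ i ∈ s, ∑ j ∈ t, (a₁ i * b₁ j) x * (a₂ i * b₂ j) y := by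
  -- Arbitrary tensors replace Δ(x) and Δ(y) so that both can be reduced to pure tensors; Δ(xy) =
  -- Δ(x)Δ(y) then gives the claim.
  have key : ∀ z w : A ⊗[k] A, mul' k k (TensorProduct.map a.ofConv b.ofConv (z * w)) =
      ∑ i ∈ s, ∑ j ∈ t, mul' k k (TensorProduct.map (a₁ i).ofConv (b₁ j).ofConv z) *
        mul' k k (TensorProduct.map (a₂ i).ofConv (b₂ j).ofConv w) := by
    intro z w
    induction z with
    | zero => simp
    | add z z' hz hz' => simp only [add_mul, map_add, hz, hz', Finset.sum_add_distrib]
    | tmul f g =>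
      induction w with
      | zero => simp
      | add w w' hw hw' => simp only [mul_add, map_add, hw, hw', Finset.sum_add_distrib]
      | tmul f' g' =>
        simp only [Algebra.TensorProduct.tmul_mul_tmul, TensorProduct.map_tmul, mul'_apply, ha, hb,
          Finset.sum_mul_sum]
        refine Finset.sum_congr rfl fun i _ => Finset.sum_congr rfl fun j _ => ?_
        ring
  simp only [convMul_apply, Bialgebra.comul_mul, key]

end LinearMap

namespace QuasiSym

theorem parts_single_of_pos (a : ℕ+) : parts (Finsupp.single (0 : ℕ) (a : ℕ)) = [a] := by
  simp [parts_single]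

-- The splittings of the exponent of x_0^a are the pairs p + q = a. A zero summand must give the
-- empty composition, hence `parts (Finsupp.single 0 p)` in place of `[p]`.
open Classical in
theorem sum_antidiagonal_singleton {A : Type*} [AddCommMonoid A] (F : List ℕ+ → List ℕ+ → A)
    (a : ℕ+) :
    ∑ p ∈ Finset.HasAntidiagonal.antidiagonal (vec [a]), F (parts p.1) (parts p.2) =
      ∑ p ∈ Finset.HasAntidiagonal.antidiagonal (a : ℕ),
        F (parts (Finsupp.single (0 : ℕ) p.1)) (parts (Finsupp.single (0 : ℕ) p.2)) := by
  have h := sum_antidiagonal_eq F (Finsupp.single (0 : ℕ) (a : ℕ))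
  rw [parts_single_of_pos] at h
  rw [← h]
  trans ∑ p ∈ Finset.HasAntidiagonal.antidiagonal (Finsupp.single (0 : ℕ) (a : ℕ)),
    F (parts p.1) (parts p.2)
  · refine Finset.sum_congr ?_ fun _ _ => rfl
    congr!
  · rw [Finsupp.antidiagonal_single, Finset.sum_map]
    rfl

end QuasiSym

/-! ### The functionals ζ_α and the canonical morphism to QSym. -/

namespace CombHopfAlg

variable {k : Type u} [Field k] (H : CombHopfAlg.{u, v} k)

/-- The homogeneous part `ζ_n` of degree `n` of the character. -/
def zetaPart (n : ℕ) : WithConv (H.carrier →ₗ[k] k) :=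
  WithConv.toConv (H.zeta.toLinearMap ∘ₗ GradedAlgebra.proj H.grading n)

theorem zetaPart_apply (n : ℕ) (x : H.carrier) :
    H.zetaPart n x = H.zeta (DirectSum.decompose H.grading x n : H.carrier) := rfl

theorem zetaPart_of_mem {n : ℕ} {x : H.carrier} (hx : x ∈ H.grading n) :
    H.zetaPart n x = H.zeta x := by
  rw [zetaPart_apply, DirectSum.decompose_of_mem_same _ hx]

theorem zetaPart_of_mem_ne {m n : ℕ} {x : H.carrier} (hx : x ∈ H.grading m) (h : m ≠ n) :
    H.zetaPart n x = 0 := by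
  rw [zetaPart_apply, DirectSum.decompose_of_mem_ne _ hx h, map_zero]

theorem mem_grading_zero {x : H.carrier} (hx : x ∈ H.grading 0) :
    algebraMap k H.carrier (Coalgebra.counit x) = x := by
  rw [H.connected] at hx
  obtain ⟨c, rfl⟩ := Submodule.mem_one.1 hx
  rw [Bialgebra.counit_algebraMap]

/-- The projection to degree zero is `x ↦ ε(x) 1`. -/
theorem decompose_zero_eq (x : H.carrier) :
    (DirectSum.decompose H.grading x 0 : H.carrier) = algebraMap k _ (Coalgebra.counit x) := by
  induction x using DirectSum.Decomposition.inductionOn H.grading with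
  | zero => simp
  | homogeneous x =>
    rename_i i
    by_cases h : i = 0
    · subst h
      rw [DirectSum.decompose_of_mem_same _ x.2, H.mem_grading_zero x.2]
    · rw [DirectSum.decompose_of_mem_ne _ x.2 h, H.counit_eq_zero i h x x.2, map_zero]
  | add x y hx hy =>
    rw [DirectSum.decompose_add, DirectSum.add_apply, Submodule.coe_add, hx, hy, map_add, map_add]

/-- This is where connectedness enters: degree zero consists of scalars, so ζ_0 is the counit, the
unit for convolution. -/
theorem zetaPart_zero : H.zetaPart 0 = 1 := by
  refine WithConv.ext (LinearMap.ext fun x => ?_)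
  change H.zetaPart 0 x = _
  rw [zetaPart_apply, decompose_zero_eq, AlgHom.commutes]
  rfl

theorem zetaPart_mul (n : ℕ) (x y : H.carrier) : H.zetaPart n (x * y) =
    ∑ p ∈ Finset.HasAntidiagonal.antidiagonal n, H.zetaPart p.1 x * H.zetaPart p.2 y := by
  simp only [zetaPart_apply]
  rw [DirectSum.decompose_mul, DirectSum.coe_mul_apply_eq_sum_antidiagonal, map_sum]
  simp

/-- The convolution product `ζ_α = ζ_{a₁} ⋯ ζ_{aₖ}` attached to a composition
`α = [a₁, …, aₖ]`. -/
def zetaConv (α : List ℕ+) : WithConv (H.carrier →ₗ[k] k) :=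
  (α.map fun a : ℕ+ => H.zetaPart a).prod

theorem zetaConv_nil : H.zetaConv [] = 1 := rfl

theorem zetaConv_append (α β : List ℕ+) :
    H.zetaConv (α ++ β) = H.zetaConv α * H.zetaConv β := by
  simp [zetaConv]

theorem zetaConv_singleton (a : ℕ+) : H.zetaConv [a] = H.zetaPart a := by
  simp [zetaConv]

theorem zetaConv_parts_single (n : ℕ) :
    H.zetaConv (QuasiSym.parts (Finsupp.single (0 : ℕ) n)) = H.zetaPart n := by
  rw [QuasiSym.parts_single]
  split_ifs with h
  · rw [zetaConv_singleton, Nat.toPNat'_coe, if_pos h]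
  · obtain rfl : n = 0 := by omega
    rw [zetaConv_nil, zetaPart_zero]

-- This is the product rule of QSym, with ζ_α in place of the coefficient of M_α. A splitting of the
-- exponent vector of a concatenation is a pair of splittings, and convolution turns concatenation
-- into products, so induction on the parts reduces to one part. There it is multiplicativity of ζ
-- on homogeneous parts.
open Classical in
theorem zetaConv_mul (α : List ℕ+) (x y : H.carrier) : H.zetaConv α (x * y) =
    ∑ p ∈ Finset.HasAntidiagonal.antidiagonal (QuasiSym.vec α),
      H.zetaConv (QuasiSym.parts p.1) x * H.zetaConv (QuasiSym.parts p.2) y := by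
  induction α generalizing x y with
  | nil =>
    have : QuasiSym.vec [] = 0 := by ext i; exact i.elim0
    rw [this, Finset.HasAntidiagonal.antidiagonal_zero, Finset.sum_singleton]
    have h : ∀ {n}, QuasiSym.parts (0 : Fin n →₀ ℕ) = [] := by intro n; simp [QuasiSym.parts]
    simp only [h, zetaConv_nil, LinearMap.convOne_apply, Bialgebra.counit_mul, map_mul]
  | cons a α ih =>
    have ha : ∀ x y, H.zetaConv [a] (x * y) =
        ∑ p ∈ Finset.HasAntidiagonal.antidiagonal (QuasiSym.vec [a]),
          H.zetaConv (QuasiSym.parts p.1) x * H.zetaConv (QuasiSym.parts p.2) y := by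
      intro x y
      rw [QuasiSym.sum_antidiagonal_singleton (fun β γ => H.zetaConv β x * H.zetaConv γ y),
        zetaConv_singleton, zetaPart_mul]
      simp only [zetaConv_parts_single]
    have h := QuasiSym.sum_antidiagonal_append
      (fun β γ => H.zetaConv β x * H.zetaConv γ y) [a] α
    rw [List.singleton_append] at h
    rw [h, ← List.singleton_append, zetaConv_append,
      LinearMap.convMul_apply_mul_of_forall _ _ ha ih]
    simp only [zetaConv_append]

/-- The coproduct preserves degree: each bidegree occurring in Δ(x) sums to n ≠ p + q, so in each
one of the two functionals vanishes. -/
theorem convMul_apply_eq_zero {f g : WithConv (H.carrier →ₗ[k] k)} {p q n : ℕ}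
    (hf : ∀ m ≠ p, ∀ x ∈ H.grading m, f x = 0) (hg : ∀ m ≠ q, ∀ x ∈ H.grading m, g x = 0)
    (hn : n ≠ p + q) {x : H.carrier} (hx : x ∈ H.grading n) : (f * g) x = 0 := by
  have hle : (⨆ r ∈ Finset.HasAntidiagonal.antidiagonal n, LinearMap.range
      (TensorProduct.map (H.grading r.1).subtype (H.grading r.2).subtype)) ≤
      LinearMap.ker (LinearMap.mul' k k ∘ₗ TensorProduct.map f.ofConv g.ofConv) := by
    refine iSup₂_le fun r hr => ?_
    rw [Finset.HasAntidiagonal.mem_antidiagonal] at hr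
    rintro _ ⟨z, rfl⟩
    rw [LinearMap.mem_ker]
    induction z with
    | zero => simp
    | add z w hz hw => rw [map_add, map_add, hz, hw, add_zero]
    | tmul y z =>
      simp only [TensorProduct.map_tmul, Submodule.subtype_apply, LinearMap.comp_apply,
        LinearMap.mul'_apply]
      by_cases h : r.1 = p
      · have h' : r.2 ≠ q := fun h' => hn (by rw [← h, ← h', hr])
        exact mul_eq_zero_of_right _ (hg _ h' _ z.2)
      · exact mul_eq_zero_of_left (hf _ h _ y.2) _
  exact hle (H.comul_mem n x hx)

/-- Degrees of support add under convolution. This makes ∑_α ζ_α(h) M_α finite and the resulting map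
graded. -/
theorem zetaConv_of_mem_ne (α : List ℕ+) {n : ℕ}
    (hn : n ≠ (α.map (fun a : ℕ+ => (a : ℕ))).sum) {x : H.carrier} (hx : x ∈ H.grading n) :
    H.zetaConv α x = 0 := by
  induction α generalizing n x with
  | nil =>
    rw [zetaConv_nil, LinearMap.convOne_apply, H.counit_eq_zero n hn x hx, map_zero]
  | cons a α ih =>
    rw [← List.singleton_append, zetaConv_append]
    refine H.convMul_apply_eq_zero (p := a) (q := (α.map (fun a : ℕ+ => (a : ℕ))).sum)
      (fun m hm y hy => ?_) (fun m hm y hy => ih hm hy) (by simpa using hn) hx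
    rw [zetaConv_singleton]
    exact H.zetaPart_of_mem_ne hy hm

theorem finite_setOf_zetaConv_ne_zero (x : H.carrier) : {α | H.zetaConv α x ≠ 0}.Finite := by
  induction x using DirectSum.Decomposition.inductionOn H.grading with
  | zero => simp
  | homogeneous x =>
    rename_i n
    refine (QuasiSym.finite_sum_eq n).subset fun α hα => ?_
    by_contra h
    exact hα (H.zetaConv_of_mem_ne α (Ne.symm h) x.2)
  | add x y hx hy =>
    refine (hx.union hy).subset fun α hα => ?_
    by_contra h
    simp only [Set.mem_union, Set.mem_ofPred_eq, not_or, not_not] at h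
    exact hα (by rw [map_add, h.1, h.2, add_zero])

/-- The linear map `h ↦ ∑_α ζ_α(h) M_α`. -/
def toQSymLin : H.carrier →ₗ[k] QuasiSym.QSym k :=
  (QuasiSym.coords k).symm.toLinearMap ∘ₗ
    { toFun := fun x => Finsupp.ofSupportFinite (fun α => H.zetaConv α x)
        (H.finite_setOf_zetaConv_ne_zero x)
      map_add' := fun x y => Finsupp.ext fun α => map_add (H.zetaConv α).ofConv x y
      map_smul' := fun r x => Finsupp.ext fun α => map_smul (H.zetaConv α).ofConv r x }

theorem coords_toQSymLin (x : H.carrier) (α : List ℕ+) :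
    QuasiSym.coords k (H.toQSymLin x) α = H.zetaConv α x := by
  simp only [toQSymLin, LinearMap.comp_apply, LinearEquiv.coe_coe, LinearEquiv.apply_symm_apply]
  rfl

/-- At z = Δ(x) the right side is (ζ_α ζ_β)(x), which is what compatibility with the coproduct
needs. -/
theorem coords₂_map_toQSymLin (α β : List ℕ+) (z : H.carrier ⊗[k] H.carrier) :
    QuasiSym.coords₂ k α β (TensorProduct.map H.toQSymLin H.toQSymLin z) =
      LinearMap.mul' k k (TensorProduct.map (H.zetaConv α).ofConv (H.zetaConv β).ofConv z) := by
  induction z with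
  | zero => simp
  | add z w hz hw => simp only [map_add, hz, hw]
  | tmul x y => simp [coords_toQSymLin]

/-- The morphism of bialgebras `h ↦ ∑_α ζ_α(h) M_α`. -/
def toQSym : H.carrier →ₐc[k] QuasiSym.QSym k :=
  BialgHom.ofAlgHom
    (AlgHom.ofLinearMap H.toQSymLin
      (by
        classical
        apply (QuasiSym.coords k).injective
        ext α
        rw [coords_toQSymLin, ← QuasiSym.M_nil, QuasiSym.coords_M, Finsupp.single_apply]
        split_ifs with h
        · rw [← h, zetaConv_nil, LinearMap.convOne_apply, Bialgebra.counit_one, map_one]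
        -- The unit has degree 0, while a nonempty composition has positive size.
        · refine H.zetaConv_of_mem_ne α (n := 0) ?_ SetLike.GradedOne.one_mem
          rcases α with _ | ⟨a, α⟩
          · exact absurd rfl h
          · have := a.pos
            rw [List.map_cons, List.sum_cons]
            omega)
      (fun x y => by
        classical
        apply (QuasiSym.coords k).injective
        ext α
        rw [coords_toQSymLin, QuasiSym.coords_mul, zetaConv_mul]
        simp only [coords_toQSymLin]))
    (by
      ext x
      change QuasiSym.counitMap k (H.toQSymLin x) = _
      rw [QuasiSym.counitMap_apply, coords_toQSymLin]
      rfl)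
    (by
      ext x
      change TensorProduct.map H.toQSymLin H.toQSymLin (Coalgebra.comul x) =
        QuasiSym.comulMap k (H.toQSymLin x)
      -- Compare coefficients of M_α ⊗ M_β: both are ζ_{αβ}(x) = (ζ_α ζ_β)(x).
      refine QuasiSym.ext₂ fun α β => ?_
      rw [QuasiSym.coords₂_comulMap, coords_toQSymLin, coords₂_map_toQSymLin, zetaConv_append]
      rfl)

theorem toQSym_apply (x : H.carrier) : H.toQSym x = H.toQSymLin x := rfl

theorem toQSymLin_mem_grade {n : ℕ} {x : H.carrier} (hx : x ∈ H.grading n) :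
    H.toQSymLin x ∈ QuasiSym.grade k n := by
  rw [QuasiSym.mem_grade]
  intro α hα
  rw [coords_toQSymLin] at hα
  by_contra h
  exact hα (H.zetaConv_of_mem_ne α (Ne.symm h) hx)

end CombHopfAlg

/-! ### Uniqueness of the morphism to QSym. -/

namespace QuasiSym

variable {k : Type u} [Field k]

/-- On the component of positive degree `a`, the character `ζ_Q` is the coefficient of `M_a`. -/
theorem zetaQ_of_mem_grade {a : ℕ+} {f : QSym k} (hf : f ∈ grade k a) :
    zetaQ k f = coords k f [a] := by
  rw [grade] at hf
  induction hf using Submodule.span_induction with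
  | mem x h =>
    obtain ⟨α, hα, rfl⟩ := h
    classical
    rw [zetaQ_M, coords_M, Finsupp.single_apply]
    rw [Set.mem_ofPred_eq] at hα
    -- Among the compositions of the positive integer a, only `[a]` has at most one part.
    refine if_congr ?_ rfl rfl
    rcases α with _ | ⟨b, _ | ⟨c, α⟩⟩
    · have := a.pos.ne
      simp_all
    · simpa using hα
    · simp
  | zero => simp
  | add x y _ _ h1 h2 => rw [map_add, h1, h2, map_add, Finsupp.add_apply]
  | smul r x _ h => rw [map_smul, h, map_smul, Finsupp.smul_apply]

/-- For one part this is `zetaQ_of_mem_grade`. In general, the coproduct is deconcatenation, so the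
convolution product of the coordinates at two compositions is the coordinate at their concatenation.
-/
theorem zetaConv_qsymCHA (α : List ℕ+) (f : QSym k) :
    (qsymCHA k).zetaConv α f = coords k f α := by
  have h1 : ∀ a : ℕ+, ((qsymCHA k).zetaPart a).ofConv =
      (Finsupp.lapply [a]).comp (coords k).toLinearMap := by
    intro a
    refine (basisM k).ext fun α => ?_
    rw [basisM_apply]
    change _ = coords k (M k α) [a]
    have hα := M_mem_grade (k := k) α
    by_cases h : (α.map (fun a : ℕ+ => (a : ℕ))).sum = a
    · rw [h] at hα
      exact ((qsymCHA k).zetaPart_of_mem hα).trans (zetaQ_of_mem_grade hα)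
    · refine ((qsymCHA k).zetaPart_of_mem_ne hα h).trans ?_
      rw [coords_M, Finsupp.single_eq_of_ne]
      rintro rfl
      simp at h
  induction α generalizing f with
  | nil => exact counitMap_apply f
  | cons a α ih =>
    have ih' : ((qsymCHA k).zetaConv α).ofConv =
      (Finsupp.lapply α).comp (coords k).toLinearMap := LinearMap.ext ih
    rw [← List.singleton_append, CombHopfAlg.zetaConv_append, ← coords₂_comulMap,
      CombHopfAlg.zetaConv_singleton, LinearMap.convMul_def, h1, ih']
    rfl

end QuasiSym

namespace CombHopfAlg

variable {k : Type u} [Field k] {H : CombHopfAlg.{u, v} k} {K : CombHopfAlg.{u, w} k}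

theorem Hom.map_decompose (f : H.Hom K) (x : H.carrier) (n : ℕ) :
    (DirectSum.decompose K.grading (f.toBialgHom x) n : K.carrier) =
      f.toBialgHom (DirectSum.decompose H.grading x n : H.carrier) :=
  DirectSum.decompose_map_of_mem H.grading K.grading
    (f.toBialgHom : H.carrier →ₗ[k] K.carrier) f.map_grading x n

theorem Hom.comul_apply (f : H.Hom K) (x : H.carrier) :
    Coalgebra.comul (R := k) (f.toBialgHom x) =
      TensorProduct.map (f.toBialgHom : H.carrier →ₗ[k] K.carrier)
        (f.toBialgHom : H.carrier →ₗ[k] K.carrier) (Coalgebra.comul x) :=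
  (CoalgHomClass.map_comp_comul_apply f.toBialgHom x).symm

theorem Hom.convMul_apply (f : H.Hom K) (a b : WithConv (K.carrier →ₗ[k] k))
    (a' b' : WithConv (H.carrier →ₗ[k] k)) (ha : ∀ x, a (f.toBialgHom x) = a' x)
    (hb : ∀ x, b (f.toBialgHom x) = b' x) (x : H.carrier) :
    (a * b) (f.toBialgHom x) = (a' * b') x := by
  rw [LinearMap.convMul_apply, LinearMap.convMul_apply, f.comul_apply, TensorProduct.map_map]
  congr 3
  · exact LinearMap.ext ha
  · exact LinearMap.ext hb

/-- Pullback along a coalgebra morphism respects convolution, and a graded morphism compatible with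
the characters pulls ζ_n back to ζ_n. -/
theorem Hom.zetaConv_apply (f : H.Hom K) (α : List ℕ+) (x : H.carrier) :
    K.zetaConv α (f.toBialgHom x) = H.zetaConv α x := by
  induction α generalizing x with
  | nil => exact congrArg (algebraMap k k) (CoalgHomClass.counit_comp_apply f.toBialgHom x)
  | cons a α ih =>
    rw [← List.singleton_append, zetaConv_append, zetaConv_append]
    refine f.convMul_apply _ _ _ _ (fun y => ?_) ih x
    rw [zetaConv_singleton, zetaConv_singleton, zetaPart_apply, zetaPart_apply, f.map_decompose,
      f.zeta_map]

/-- In positive degree a, ζ_Q reads off the coefficient of M_a, which for Ψ(x) is ζ_a(x) = ζ(x).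
Degree 0 is scalar by connectedness. -/
theorem zetaQ_toQSym (H : CombHopfAlg.{u, v} k) (x : H.carrier) :
    QuasiSym.zetaQ k (H.toQSym x) = H.zeta x := by
  induction x using DirectSum.Decomposition.inductionOn H.grading with
  | zero => simp
  | homogeneous x =>
    rename_i n
    rcases Nat.eq_zero_or_pos n with rfl | hn
    · rw [← H.mem_grading_zero x.2]
      generalize Coalgebra.counit (R := k) (x : H.carrier) = c
      rw [Algebra.algebraMap_eq_smul_one, map_smul, map_one, map_smul, map_one, map_smul, map_one]
    · lift n to ℕ+ using hn
      rw [toQSym_apply, QuasiSym.zetaQ_of_mem_grade (H.toQSymLin_mem_grade x.2), coords_toQSymLin,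
        zetaConv_singleton, H.zetaPart_of_mem x.2]
  | add x y hx hy => simp only [map_add, hx, hy]

/-- The canonical morphism from a combinatorial Hopf algebra to `(QSym, ζ_Q)`. -/
def homQSym (H : CombHopfAlg.{u, v} k) : H.Hom (qsymCHA k) :=
  ⟨H.toQSym, fun _ _ hx => H.toQSymLin_mem_grade hx, H.zetaQ_toQSym⟩

/-- The coefficient of M_α in the image of x is ζ_α of that image, hence ζ_α(x), whatever the
morphism. -/
theorem hom_qsym_ext (f g : H.Hom (qsymCHA k)) : f = g := by
  refine Hom.ext (BialgHom.ext fun x => (QuasiSym.coords k).injective (Finsupp.ext fun α => ?_))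
  exact (QuasiSym.zetaConv_qsymCHA α _).symm.trans (((f.zetaConv_apply α x).trans
    (g.zetaConv_apply α x).symm).trans (QuasiSym.zetaConv_qsymCHA α _))

end CombHopfAlg

/-! ### Images of even and odd objects; the largest subcoalgebra is a subalgebra. -/

namespace CombHopfAlg

variable {k : Type u} [Field k] {H : CombHopfAlg.{u, v} k} {K : CombHopfAlg.{u, w} k}

theorem Hom.map_bar (f : H.Hom K) (x : H.carrier) :
    K.bar (f.toBialgHom x) = f.toBialgHom (H.bar x) := by
  induction x using DirectSum.Decomposition.inductionOn H.grading with
  | zero => simp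
  | homogeneous x => rw [H.bar_of_mem x.2, K.bar_of_mem (f.map_grading _ _ x.2), map_smul]
  | add x y hx hy => simp only [map_add, hx, hy]

theorem Hom.zetaBar_apply (f : H.Hom K) (x : H.carrier) :
    K.zetaBar (f.toBialgHom x) = H.zetaBar x := by
  rw [zetaBar, LinearMap.comp_apply, f.map_bar]
  exact f.zeta_map _

/-- In the convolution algebra of maps H → K, f ∘ S is a left inverse of f and S ∘ f a right
inverse, so they coincide. -/
theorem Hom.map_antipode (f : H.Hom K) (x : H.carrier) :
    f.toBialgHom (HopfAlgebra.antipode k x) = HopfAlgebra.antipode k (f.toBialgHom x) := by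
  let g : WithConv (H.carrier →ₗ[k] K.carrier) :=
    WithConv.toConv (f.toBialgHom : H.carrier →ₗ[k] K.carrier)
  have h1 : WithConv.toConv (g.ofConv ∘ₗ HopfAlgebra.antipode k) * g = 1 := by
    have h := LinearMap.algHom_comp_convMul_distrib (f.toBialgHom : H.carrier →ₐ[k] K.carrier)
      (WithConv.toConv (HopfAlgebra.antipode k)) (WithConv.toConv LinearMap.id)
    rw [LinearMap.antipode_mul_id] at h
    refine (congrArg WithConv.toConv h).symm.trans (WithConv.ext (LinearMap.ext fun y => ?_))
    exact AlgHomClass.commutes f.toBialgHom _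
  have h2 : g * WithConv.toConv (HopfAlgebra.antipode k ∘ₗ g.ofConv) = 1 := by
    have h := LinearMap.convMul_comp_coalgHom_distrib
      (WithConv.toConv LinearMap.id) (WithConv.toConv (HopfAlgebra.antipode k))
      (f.toBialgHom : H.carrier →ₗc[k] K.carrier)
    rw [LinearMap.id_mul_antipode] at h
    refine (congrArg WithConv.toConv h).symm.trans (WithConv.ext (LinearMap.ext fun y => ?_))
    exact congrArg (algebraMap k K.carrier) (CoalgHomClass.counit_comp_apply f.toBialgHom y)
  exact LinearMap.congr_fun (congrArg WithConv.ofConv (left_inv_eq_right_inv h1 h2)) x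

theorem Hom.zetaInv_apply (f : H.Hom K) (x : H.carrier) :
    K.zetaInv (f.toBialgHom x) = H.zetaInv x := by
  rw [zetaInv, LinearMap.comp_apply, ← f.map_antipode]
  exact f.zeta_map _

theorem Hom.isGradedSubcoalgebra_image (f : H.Hom K) : IsGradedSubcoalgebra f.image where
  homogeneous := by
    rintro _ ⟨x, rfl⟩ n
    exact ⟨_, (f.map_decompose x n).symm⟩
  comul_mem := by
    rintro _ ⟨x, rfl⟩
    let r : H.carrier →ₗ[k] f.image :=
      LinearMap.rangeRestrict (f.toBialgHom : H.carrier →ₗ[k] K.carrier)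
    refine ⟨TensorProduct.map r r (Coalgebra.comul x), ?_⟩
    rw [TensorProduct.map_map]
    exact (f.comul_apply x).symm

/-- The image is a graded subcoalgebra, and equality of the two functionals on it can be tested
after pulling back to H, so maximality applies. -/
theorem Hom.image_le_evenSubalgebra (f : H.Hom K) (hH : H.IsEven) :
    f.image ≤ K.evenSubalgebra := by
  refine (K.isGreatest_eqSubcoalgebra _ _).2 ⟨f.isGradedSubcoalgebra_image, ?_⟩
  rintro _ ⟨x, rfl⟩
  exact (f.zetaBar_apply x).trans ((LinearMap.congr_fun hH x).trans (f.zeta_map x).symm)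

theorem Hom.image_le_oddSubalgebra (f : H.Hom K) (hH : H.IsOdd) :
    f.image ≤ K.oddSubalgebra := by
  refine (K.isGreatest_eqSubcoalgebra _ _).2 ⟨f.isGradedSubcoalgebra_image, ?_⟩
  rintro _ ⟨x, rfl⟩
  exact (f.zetaBar_apply x).trans ((LinearMap.congr_fun hH x).trans (f.zetaInv_apply x).symm)

theorem bar_mul (H : CombHopfAlg.{u, v} k) (x y : H.carrier) :
    H.bar (x * y) = H.bar x * H.bar y := by
  induction x using DirectSum.Decomposition.inductionOn H.grading with
  | zero => simp
  | add x x' hx hx' => simp only [add_mul, map_add, hx, hx']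
  | homogeneous x =>
    induction y using DirectSum.Decomposition.inductionOn H.grading with
    | zero => simp
    | add y y' hy hy' => simp only [mul_add, map_add, hy, hy']
    | homogeneous y =>
      rw [H.bar_of_mem x.2, H.bar_of_mem y.2, H.bar_of_mem (SetLike.GradedMul.mul_mem x.2 y.2),
        smul_mul_smul_comm, pow_add]

variable (H) in
/-- The character `ζ̄` as a morphism of algebras. -/
def zetaBarAlgHom : H.carrier →ₐ[k] k :=
  AlgHom.ofLinearMap H.zetaBar
    (by
      have h := H.bar_of_mem (n := 0) SetLike.GradedOne.one_mem
      rw [pow_zero, one_smul] at h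
      rw [zetaBar, LinearMap.comp_apply, h]
      exact map_one H.zeta)
    (fun x y => by
      simp only [zetaBar, LinearMap.comp_apply, bar_mul]
      exact map_mul H.zeta _ _)

variable (H) in
/-- The character `ζ⁻¹` as a morphism of algebras. -/
def zetaInvAlgHom : H.carrier →ₐ[k] k :=
  AlgHom.ofLinearMap H.zetaInv
    (by
      rw [zetaInv, LinearMap.comp_apply, HopfAlgebra.antipode_one]
      exact map_one H.zeta)
    (fun x y => by
      -- The antipode reverses products, which does no harm because ζ takes values in a commutative
      -- field.
      simp only [zetaInv, LinearMap.comp_apply, HopfAlgebra.antipode_mul_antidistrib]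
      exact (map_mul H.zeta _ _).trans (mul_comm _ _))

theorem IsGradedSubcoalgebra.one : IsGradedSubcoalgebra (H := H) 1 where
  homogeneous := by
    intro h hh n
    rw [← H.connected] at hh ⊢
    by_cases hn : n = 0
    · subst hn
      exact SetLike.coe_mem _
    · rw [DirectSum.decompose_of_mem_ne _ hh (Ne.symm hn)]
      exact zero_mem _
  comul_mem := by
    intro h hh
    obtain ⟨c, rfl⟩ := Submodule.mem_one.1 hh
    refine ⟨⟨_, hh⟩ ⊗ₜ ⟨1, Submodule.one_le.1 le_rfl⟩, ?_⟩
    rw [Bialgebra.comul_algebraMap]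
    rfl

/-- Since Δ is multiplicative, Δ(CD) ⊆ (C ⊗ C)(D ⊗ D) ⊆ CD ⊗ CD. Applied with C = D, this lets
maximality prove closure under products. -/
theorem IsGradedSubcoalgebra.mul {C D : Submodule k H.carrier} (hC : IsGradedSubcoalgebra C)
    (hD : IsGradedSubcoalgebra D) : IsGradedSubcoalgebra (C * D) where
  homogeneous := by
    intro h hh n
    induction hh using Submodule.mul_induction_on' with
    | mem_mul_mem x hx y hy =>
      rw [DirectSum.decompose_mul, DirectSum.coe_mul_apply_eq_sum_antidiagonal]
      exact sum_mem fun p _ =>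
        Submodule.mul_mem_mul (hC.homogeneous x hx _) (hD.homogeneous y hy _)
    | add x _ y _ hx hy =>
      rw [DirectSum.decompose_add]
      exact add_mem hx hy
  comul_mem := by
    intro h hh
    induction hh using Submodule.mul_induction_on' with
    | mem_mul_mem x hx y hy =>
      obtain ⟨a, ha⟩ := hC.comul_mem x hx
      obtain ⟨b, hb⟩ := hD.comul_mem y hy
      rw [Bialgebra.comul_mul, ← ha, ← hb]
      clear ha hb
      induction a with
      | zero => simp
      | add a a' h h' => rw [map_add, add_mul]; exact add_mem h h'
      | tmul c c' =>
        induction b with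
        | zero => simp
        | add b b' h h' => rw [map_add, mul_add]; exact add_mem h h'
        | tmul d d' =>
          exact ⟨⟨_, Submodule.mul_mem_mul c.2 d.2⟩ ⊗ₜ ⟨_, Submodule.mul_mem_mul c'.2 d'.2⟩,
            (Algebra.TensorProduct.tmul_mul_tmul (c : H.carrier) (d : H.carrier) (c' : H.carrier)
              (d' : H.carrier)).symm⟩
    | add x _ y _ hx hy =>
      rw [map_add]
      exact add_mem hx hy

variable (H) in
/-- The largest graded subcoalgebra on which two characters agree, as a subalgebra. -/
def eqSubalgebra (φ ψ : H.carrier →ₐ[k] k) : Subalgebra k H.carrier :=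
  (H.eqSubcoalgebra φ.toLinearMap ψ.toLinearMap).toSubalgebra
    (Submodule.one_le.1 <| (H.isGreatest_eqSubcoalgebra _ _).2 ⟨.one, fun h hh => by
      obtain ⟨c, rfl⟩ := Submodule.mem_one.1 hh
      exact (φ.commutes c).trans (ψ.commutes c).symm⟩)
    (fun x y hx hy => by
      -- Two characters agreeing on C agree on C · C, again a graded subcoalgebra, so C · C ⊆ C by
      -- maximality.
      have hg := (H.isGreatest_eqSubcoalgebra φ.toLinearMap ψ.toLinearMap).1
      refine (H.isGreatest_eqSubcoalgebra _ _).2 ⟨hg.1.mul hg.1, fun h hh => ?_⟩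
        (Submodule.mul_mem_mul hx hy)
      induction hh using Submodule.mul_induction_on' with
      | mem_mul_mem x hx y hy =>
        exact (map_mul φ x y).trans ((congrArg₂ _ (hg.2 x hx) (hg.2 y hy)).trans
          (map_mul ψ x y).symm)
      | add x _ y _ hx hy => rw [map_add, map_add, hx, hy])

end CombHopfAlg

/-! ### Hopf structures inherited along an injection. -/

section Injective

variable {k : Type*} [Field k]

/-- Vector spaces are flat. Identities in A ⊗ A can therefore be checked in B ⊗ B, the principle
behind all the inherited structures. -/
theorem TensorProduct.map_self_injective {A B : Type*} [AddCommGroup A] [Module k A]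
    [AddCommGroup B] [Module k B] {i : A →ₗ[k] B} (hi : Function.Injective i) :
    Function.Injective (TensorProduct.map i i) :=
  TensorProduct.map_injective_of_flat_flat _ _ hi hi

/-- A coalgebra structure on a subspace closed under the coproduct. -/
@[reducible]
def coalgebraOfInjective {A B : Type*} [AddCommGroup A] [Module k A] [AddCommGroup B]
    [Module k B] [Coalgebra k B] (i : A →ₗ[k] B) (hi : Function.Injective i) (Δ : A →ₗ[k] A ⊗[k] A)
    (hΔ : ∀ x, TensorProduct.map i i (Δ x) = Coalgebra.comul (i x)) : Coalgebra k A where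
  comul := Δ
  counit := Coalgebra.counit ∘ₗ i
  coassoc := by
    -- Coassociativity is tested after embedding in B ⊗ (B ⊗ B), where it is that of B.
    have hi₃ : Function.Injective (TensorProduct.map i (TensorProduct.map i i)) :=
      TensorProduct.map_injective_of_flat_flat _ _ hi (TensorProduct.map_self_injective hi)
    have hΔ' : TensorProduct.map i i ∘ₗ Δ = Coalgebra.comul ∘ₗ i := LinearMap.ext hΔ
    have h1 : TensorProduct.map i (TensorProduct.map i i) ∘ₗ TensorProduct.assoc k A A A ∘ₗ
        Δ.rTensor A = TensorProduct.assoc k B B B ∘ₗ Coalgebra.comul.rTensor B ∘ₗ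
          TensorProduct.map i i := by
      have : TensorProduct.map i (TensorProduct.map i i) ∘ₗ
          (TensorProduct.assoc k A A A).toLinearMap =
          (TensorProduct.assoc k B B B).toLinearMap ∘ₗ
            TensorProduct.map (TensorProduct.map i i) i := by
        ext; simp
      rw [← LinearMap.comp_assoc, this, LinearMap.comp_assoc]
      congr 1
      ext x y
      simp [hΔ]
    have h2 : TensorProduct.map i (TensorProduct.map i i) ∘ₗ Δ.lTensor A =
        Coalgebra.comul.lTensor B ∘ₗ TensorProduct.map i i := by
      ext x y
      simp [hΔ]
    refine LinearMap.ext fun x => hi₃ ?_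
    have e1 := LinearMap.congr_fun h1 (Δ x)
    have e2 := LinearMap.congr_fun h2 (Δ x)
    simp only [LinearMap.comp_apply, hΔ] at e1 e2 ⊢
    rw [e1, e2]
    exact Coalgebra.coassoc_apply (i x)
  rTensor_counit_comp_comul := by
    have hi₂ : Function.Injective (i.lTensor k) :=
      Module.Flat.lTensor_preserves_injective_linearMap i hi
    have h : i.lTensor k ∘ₗ (Coalgebra.counit ∘ₗ i).rTensor A =
        Coalgebra.counit.rTensor B ∘ₗ TensorProduct.map i i := by
      ext; simp
    refine LinearMap.ext fun x => hi₂ ?_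
    have e := LinearMap.congr_fun h (Δ x)
    simp only [LinearMap.comp_apply, hΔ] at e ⊢
    rw [e, Coalgebra.rTensor_counit_comul]
    simp
  lTensor_counit_comp_comul := by
    have hi₂ : Function.Injective (i.rTensor k) :=
      Module.Flat.rTensor_preserves_injective_linearMap i hi
    have h : i.rTensor k ∘ₗ (Coalgebra.counit ∘ₗ i).lTensor A =
        Coalgebra.counit.lTensor B ∘ₗ TensorProduct.map i i := by
      ext; simp
    refine LinearMap.ext fun x => hi₂ ?_
    have e := LinearMap.congr_fun h (Δ x)
    simp only [LinearMap.comp_apply, hΔ] at e ⊢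
    rw [e, Coalgebra.lTensor_counit_comul]
    simp

/-- A bialgebra structure on a subalgebra closed under the coproduct. -/
@[reducible]
def bialgebraOfInjective {A B : Type*} [Ring A] [Algebra k A] [Ring B] [Bialgebra k B]
    (i : A →ₐ[k] B) (hi : Function.Injective i) (Δ : A →ₗ[k] A ⊗[k] A)
    (hΔ : ∀ x, TensorProduct.map i.toLinearMap i.toLinearMap (Δ x) = Coalgebra.comul (i x)) :
    Bialgebra k A :=
  letI := coalgebraOfInjective i.toLinearMap hi Δ hΔ
  have hi₂ : Function.Injective (Algebra.TensorProduct.map i i) :=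
    TensorProduct.map_self_injective (i := i.toLinearMap) hi
  have hΔ' : ∀ x, Algebra.TensorProduct.map i i (Δ x) = Coalgebra.comul (i x) := hΔ
  Bialgebra.mk' k A
    ((congrArg _ (map_one i)).trans Bialgebra.counit_one)
    (fun {a b} => (congrArg _ (map_mul i a b)).trans (Bialgebra.counit_mul _ _))
    (hi₂ ((hΔ' 1).trans (by rw [map_one i, Bialgebra.comul_one, map_one])))
    (fun {a b} => hi₂ ((hΔ' (a * b)).trans (by
      rw [map_mul, Bialgebra.comul_mul, map_mul, ← hΔ', ← hΔ']
      rfl)))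

/-- A Hopf algebra structure on a subalgebra closed under the coproduct and the antipode. -/
@[reducible]
def hopfAlgebraOfInjective {A B : Type*} [Ring A] [Algebra k A] [Ring B] [HopfAlgebra k B]
    (i : A →ₐ[k] B) (hi : Function.Injective i) (Δ : A →ₗ[k] A ⊗[k] A)
    (hΔ : ∀ x, TensorProduct.map i.toLinearMap i.toLinearMap (Δ x) = Coalgebra.comul (i x))
    (S : A →ₗ[k] A) (hS : ∀ x, i (S x) = HopfAlgebra.antipode k (i x)) : HopfAlgebra k A :=
  letI := bialgebraOfInjective i hi Δ hΔ
  { antipode := S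
    mul_antipode_rTensor_comul := by
      have h : i.toLinearMap ∘ₗ LinearMap.mul' k A ∘ₗ S.rTensor A =
          LinearMap.mul' k B ∘ₗ (HopfAlgebra.antipode k).rTensor B ∘ₗ
            TensorProduct.map i.toLinearMap i.toLinearMap := by
        ext; simp [hS]
      refine LinearMap.ext fun x => hi ?_
      have e := LinearMap.congr_fun h (Δ x)
      simp only [LinearMap.comp_apply, hΔ] at e
      refine e.trans ((HopfAlgebra.mul_antipode_rTensor_comul_apply (i x)).trans ?_)
      exact (i.commutes _).symm
    mul_antipode_lTensor_comul := by
      have h : i.toLinearMap ∘ₗ LinearMap.mul' k A ∘ₗ S.lTensor A =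
          LinearMap.mul' k B ∘ₗ (HopfAlgebra.antipode k).lTensor B ∘ₗ
            TensorProduct.map i.toLinearMap i.toLinearMap := by
        ext; simp [hS]
      refine LinearMap.ext fun x => hi ?_
      have e := LinearMap.congr_fun h (Δ x)
      simp only [LinearMap.comp_apply, hΔ] at e
      refine e.trans ((HopfAlgebra.mul_antipode_lTensor_comul_apply (i x)).trans ?_)
      exact (i.commutes _).symm }

end Injective

/-! ### Bihomogeneous components and gradings of homogeneous subspaces. -/

namespace DirectSum

variable {k A B : Type*} [Field k] [AddCommGroup A] [AddCommGroup B] [Module k A] [Module k B]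

/-- The projection to a component, as a linear endomorphism. -/
def projLin (𝒜 : ℕ → Submodule k A) [Decomposition 𝒜] (n : ℕ) : A →ₗ[k] A :=
  (𝒜 n).subtype ∘ₗ component k ℕ (fun n => 𝒜 n) n ∘ₗ (decomposeLinearEquiv 𝒜).toLinearMap

variable (𝒜 : ℕ → Submodule k A) [Decomposition 𝒜]

theorem projLin_apply (n : ℕ) (x : A) : projLin 𝒜 n x = (decompose 𝒜 x n : A) := rfl

/-- The bound is stated for all m ≥ N, so that the bounds of several elements can be merged by
taking a maximum. -/
theorem exists_eq_sum_range_projLin (x : A) :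
    ∃ N, ∀ m, N ≤ m → ∑ p ∈ Finset.range m, projLin 𝒜 p x = x := by
  induction x using Decomposition.inductionOn 𝒜 with
  | zero => exact ⟨0, by simp⟩
  | homogeneous x =>
    rename_i n
    refine ⟨n + 1, fun m hm => ?_⟩
    rw [Finset.sum_eq_single n]
    · exact decompose_of_mem_same 𝒜 x.2
    · exact fun p _ hp => decompose_of_mem_ne 𝒜 x.2 hp.symm
    · intro h
      exact absurd (Finset.mem_range.2 hm) h
  | add x y hx hy =>
    obtain ⟨N, hN⟩ := hx
    obtain ⟨N', hN'⟩ := hy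
    refine ⟨max N N', fun m hm => ?_⟩
    simp only [map_add, Finset.sum_add_distrib]
    rw [hN m (le_trans (le_max_left _ _) hm), hN' m (le_trans (le_max_right _ _) hm)]

theorem exists_eq_sum_range_map_projLin (z : A ⊗[k] A) :
    ∃ N, ∀ m, N ≤ m → ∑ p ∈ Finset.range m, ∑ q ∈ Finset.range m,
      TensorProduct.map (projLin 𝒜 p) (projLin 𝒜 q) z = z := by
  induction z with
  | zero => exact ⟨0, by simp⟩
  | tmul x y =>
    obtain ⟨N, hN⟩ := exists_eq_sum_range_projLin 𝒜 x
    obtain ⟨N', hN'⟩ := exists_eq_sum_range_projLin 𝒜 y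
    refine ⟨max N N', fun m hm => ?_⟩
    simp only [TensorProduct.map_tmul]
    conv_rhs => rw [← hN m (le_trans (le_max_left _ _) hm),
      ← hN' m (le_trans (le_max_right _ _) hm), TensorProduct.sum_tmul]
    simp only [TensorProduct.tmul_sum]
  | add x y hx hy =>
    obtain ⟨N, hN⟩ := hx
    obtain ⟨N', hN'⟩ := hy
    refine ⟨max N N', fun m hm => ?_⟩
    simp only [map_add, Finset.sum_add_distrib]
    rw [hN m (le_trans (le_max_left _ _) hm), hN' m (le_trans (le_max_right _ _) hm)]

/-- A tensor whose bihomogeneous components vanish outside the set of bidegrees `P` lies in the sum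
of the bihomogeneous components with bidegree in `P`. -/
theorem mem_iSup_of_map_projLin_eq_zero (P : ℕ × ℕ → Prop) (z : A ⊗[k] A)
    (hz : ∀ p, ¬ P p → TensorProduct.map (projLin 𝒜 p.1) (projLin 𝒜 p.2) z = 0) :
    z ∈ ⨆ (p) (_ : P p),
      LinearMap.range (TensorProduct.map (𝒜 p.1).subtype (𝒜 p.2).subtype) := by
  obtain ⟨N, hN⟩ := exists_eq_sum_range_map_projLin 𝒜 z
  rw [← hN N le_rfl]
  refine sum_mem fun p _ => sum_mem fun q _ => ?_
  by_cases h : P (p, q)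
  · refine Submodule.mem_iSup_of_mem (p, q) (Submodule.mem_iSup_of_mem h ?_)
    rw [projLin, projLin, TensorProduct.map_comp]
    exact ⟨_, rfl⟩
  · rw [hz (p, q) h]
    exact zero_mem _

/-- A bidegree in P differs from p in some coordinate, and the projection there kills the term. With
the preceding lemma, membership in the sum becomes a vanishing condition, which transfers along
injections. -/
theorem map_projLin_eq_zero_of_mem_iSup {P : ℕ × ℕ → Prop} {z : A ⊗[k] A}
    (hz : z ∈ ⨆ (p) (_ : P p),
      LinearMap.range (TensorProduct.map (𝒜 p.1).subtype (𝒜 p.2).subtype))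
    {p : ℕ × ℕ} (hp : ¬ P p) : TensorProduct.map (projLin 𝒜 p.1) (projLin 𝒜 p.2) z = 0 := by
  have hle : (⨆ (p) (_ : P p),
      LinearMap.range (TensorProduct.map (𝒜 p.1).subtype (𝒜 p.2).subtype)) ≤
      LinearMap.ker (TensorProduct.map (projLin 𝒜 p.1) (projLin 𝒜 p.2)) := by
    refine iSup₂_le fun r hr => ?_
    rintro _ ⟨w, rfl⟩
    rw [LinearMap.mem_ker]
    induction w with
    | zero => simp
    | add z w hz hw => rw [map_add, map_add, hz, hw, add_zero]
    | tmul y z =>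
      simp only [TensorProduct.map_tmul, Submodule.subtype_apply, projLin_apply]
      by_cases h : r.1 = p.1
      · have h' : r.2 ≠ p.2 := fun h' => hp (Prod.ext h h' ▸ hr)
        rw [decompose_of_mem_ne 𝒜 z.2 h', TensorProduct.tmul_zero]
      · rw [decompose_of_mem_ne 𝒜 y.2 h, TensorProduct.zero_tmul]
  exact hle hz

/-- The grading of a homogeneous subspace. -/
@[reducible]
def Decomposition.ofInjective (ℬ : ℕ → Submodule k B) [Decomposition ℬ] (i : A →ₗ[k] B)
    (hi : Function.Injective i)
    (h : ∀ x n, (decompose ℬ (i x) n : B) ∈ LinearMap.range i) :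
    Decomposition fun n => (ℬ n).comap i := by
  classical
  refine IsInternal.chooseDecomposition _ ⟨fun z w hzw => ?_, fun x => ?_⟩
  -- Each component of z is recovered from the image of its total sum, so the sum determines z.
  · have key : ∀ (z : ⨁ n, (ℬ n).comap i) (n : ℕ),
        (decompose ℬ (i (DirectSum.coeAddMonoidHom (fun n => (ℬ n).comap i) z)) n : B) =
          i (z n) := by
      intro z n
      induction z using DirectSum.induction_on with
      | zero => simp
      | of m y =>
        rw [coeAddMonoidHom_of]
        by_cases hmn : m = n
        · subst hmn
          rw [of_eq_same]
          exact decompose_of_mem_same ℬ y.2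
        · rw [of_eq_of_ne _ _ _ (Ne.symm hmn), ZeroMemClass.coe_zero, map_zero]
          exact decompose_of_mem_ne ℬ y.2 hmn
      | add z w hz hw =>
        rw [map_add, map_add, decompose_add, add_apply, Submodule.coe_add, hz, hw, ← map_add]
        rfl
    refine DFinsupp.ext fun n => Subtype.ext (hi ?_)
    rw [← key z n, ← key w n, hzw]
  -- Lift each homogeneous component of i(x) to A; the finitely many lifts needed add up to x
  -- because i is injective.
  · choose g hg using fun n => h x n
    obtain ⟨N, hN⟩ := exists_eq_sum_range_projLin ℬ (i x)
    refine ⟨∑ n ∈ Finset.range N, of (fun n => (ℬ n).comap i) n ⟨g n, ?_⟩, ?_⟩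
    · rw [Submodule.mem_comap, hg]
      exact SetLike.coe_mem _
    · rw [map_sum]
      simp only [coeAddMonoidHom_of]
      apply hi
      rw [map_sum]
      simp only [hg]
      exact hN N le_rfl

end DirectSum

/-! ### Subalgebras that are graded subcoalgebras are combinatorial Hopf algebras. -/

namespace CombHopfAlg

variable {k : Type u} [Field k] (H : CombHopfAlg.{u, v} k)

/-- By connectedness the projection to degree 0 is the counit, so the counit axiom identifies the
(n, 0) component of Δ(x) as x ⊗ 1. Once it is removed, every left factor has degree below n, which
allows recursion for the antipode. -/
theorem map_projLin_comul_sub {n : ℕ} {x : H.carrier} (hx : x ∈ H.grading n) {p : ℕ × ℕ}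
    (hp : ¬ (p.1 + p.2 = n ∧ p.1 < n)) :
    TensorProduct.map (DirectSum.projLin H.grading p.1) (DirectSum.projLin H.grading p.2)
      (Coalgebra.comul (R := k) x - x ⊗ₜ 1) = 0 := by
  have hone : (1 : H.carrier) ∈ H.grading 0 := SetLike.GradedOne.one_mem
  obtain ⟨p, q⟩ := p
  rw [map_sub, TensorProduct.map_tmul, DirectSum.projLin_apply, DirectSum.projLin_apply]
  by_cases hpq : p + q = n
  -- The only excluded bidegree on the line p + q = n is (n, 0).
  · obtain ⟨rfl, rfl⟩ : p = n ∧ q = 0 := by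
      simp only [not_and, not_lt] at hp
      have := hp hpq
      omega
    have h0 : DirectSum.projLin H.grading 0 =
        Algebra.linearMap k H.carrier ∘ₗ Coalgebra.counit :=
      LinearMap.ext fun y => H.decompose_zero_eq y
    have h1 : TensorProduct.map (DirectSum.projLin H.grading p) (DirectSum.projLin H.grading 0) =
        TensorProduct.map (DirectSum.projLin H.grading p) (Algebra.linearMap k H.carrier) ∘ₗ
          Coalgebra.counit.lTensor H.carrier := by
      rw [LinearMap.lTensor, ← TensorProduct.map_comp, h0, LinearMap.comp_id]
    rw [h1, LinearMap.comp_apply, Coalgebra.lTensor_counit_comul, TensorProduct.map_tmul,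
      DirectSum.decompose_of_mem_same _ hone, Algebra.linearMap_apply, map_one,
      DirectSum.projLin_apply, sub_self]
  · rw [DirectSum.map_projLin_eq_zero_of_mem_iSup H.grading (H.comul_mem n x hx) (p := (p, q))
      (by rwa [Finset.HasAntidiagonal.mem_antidiagonal]), zero_sub, neg_eq_zero]
    by_cases h : n = p
    · have h' : 0 ≠ q := by omega
      rw [DirectSum.decompose_of_mem_ne _ hone h', TensorProduct.tmul_zero]
    · rw [DirectSum.decompose_of_mem_ne _ hx h, TensorProduct.zero_tmul]

section Sub

variable {H} {A : Subalgebra k H.carrier}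

/-- The coproduct of a subalgebra that is a subcoalgebra. -/
def subComul (hA : IsGradedSubcoalgebra (Subalgebra.toSubmodule A)) : A →ₗ[k] A ⊗[k] A :=
  (LinearEquiv.ofInjective (TensorProduct.map A.val.toLinearMap A.val.toLinearMap)
      (TensorProduct.map_self_injective (i := A.val.toLinearMap)
        Subtype.val_injective)).symm.toLinearMap ∘ₗ
    LinearMap.codRestrict _ (Coalgebra.comul ∘ₗ A.val.toLinearMap)
      (fun x => hA.comul_mem x x.2)

theorem map_subComul (hA : IsGradedSubcoalgebra (Subalgebra.toSubmodule A))
    (x : A) : TensorProduct.map A.val.toLinearMap A.val.toLinearMap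
    (subComul hA x) = Coalgebra.comul (A.val x) := by
  have h := LinearEquiv.apply_symm_apply
    (LinearEquiv.ofInjective (TensorProduct.map A.val.toLinearMap A.val.toLinearMap)
      (TensorProduct.map_self_injective (i := A.val.toLinearMap) Subtype.val_injective))
    (LinearMap.codRestrict _ (Coalgebra.comul ∘ₗ A.val.toLinearMap)
      (fun x => hA.comul_mem x x.2) x)
  exact congrArg Subtype.val h

/-- The homogeneous components of a subalgebra. -/
def subGrading (A : Subalgebra k H.carrier) (n : ℕ) : Submodule k A :=
  (H.grading n).comap A.val.toLinearMap

/-- A subalgebra that is a graded subcoalgebra is graded. -/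
@[reducible]
def subGraded (hA : IsGradedSubcoalgebra (Subalgebra.toSubmodule A)) :
    GradedAlgebra (subGrading A) :=
  letI : DirectSum.Decomposition (subGrading A) :=
    DirectSum.Decomposition.ofInjective H.grading A.val.toLinearMap Subtype.val_injective
      fun x n => ⟨⟨_, hA.homogeneous x x.2 n⟩, rfl⟩
  { one_mem := SetLike.GradedOne.one_mem (A := H.grading)
    mul_mem := fun _ _ _ _ hx hy => SetLike.GradedMul.mul_mem (A := H.grading) hx hy }

theorem map_projLin_sub (hA : IsGradedSubcoalgebra (Subalgebra.toSubmodule A))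
    (p q : ℕ) (z : A ⊗[k] A) :
    letI := subGraded hA
    TensorProduct.map A.val.toLinearMap A.val.toLinearMap (TensorProduct.map
      (DirectSum.projLin (subGrading A) p) (DirectSum.projLin (subGrading A) q) z) =
    TensorProduct.map (DirectSum.projLin H.grading p) (DirectSum.projLin H.grading q)
      (TensorProduct.map A.val.toLinearMap A.val.toLinearMap z) := by
  let := subGraded hA
  have h : ∀ n, A.val.toLinearMap ∘ₗ DirectSum.projLin (subGrading A) n =
      DirectSum.projLin H.grading n ∘ₗ A.val.toLinearMap := fun n => LinearMap.ext fun x =>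
    (DirectSum.decompose_map_of_mem (subGrading A) H.grading A.val.toLinearMap
      (fun _ _ h => h) x n).symm
  rw [TensorProduct.map_map, TensorProduct.map_map, h, h]

/-- The projections of A are restrictions of those of H and A ⊗ A embeds in H ⊗ H, so the bidegrees
of z can be read off in H ⊗ H. -/
theorem mem_iSup_subGrading (hA : IsGradedSubcoalgebra (Subalgebra.toSubmodule A))
    (P : ℕ × ℕ → Prop) (z : A ⊗[k] A)
    (hz : ∀ p, ¬ P p → TensorProduct.map (DirectSum.projLin H.grading p.1)
      (DirectSum.projLin H.grading p.2)
      (TensorProduct.map A.val.toLinearMap A.val.toLinearMap z) = 0) :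
    z ∈ ⨆ (p) (_ : P p), LinearMap.range
      (TensorProduct.map (subGrading A p.1).subtype (subGrading A p.2).subtype) := by
  let := subGraded hA
  refine DirectSum.mem_iSup_of_map_projLin_eq_zero (subGrading A) P z fun p hp => ?_
  refine TensorProduct.map_self_injective (i := A.val.toLinearMap) Subtype.val_injective ?_
  rw [map_projLin_sub hA, hz p hp, map_zero]

/-- Write Δ(x) = x ⊗ 1 + ∑ x' ⊗ x'' with deg x' < n. The antipode axiom gives S(x) = ε(x)1 - ∑
S(x')x'', and S(x') ∈ A by induction. -/
theorem antipode_mem_of_mem_grading (hA : IsGradedSubcoalgebra (Subalgebra.toSubmodule A))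
    (n : ℕ) (x : H.carrier) (hx : x ∈ A)
    (hn : x ∈ H.grading n) : HopfAlgebra.antipode k x ∈ A := by
  induction n using Nat.strong_induction_on generalizing x with
  | _ n ih =>
    -- The difference Δ(x) - x ⊗ 1 is formed in A ⊗ A, so that both tensor factors are known to lie
    -- in A.
    let z : A ⊗[k] A := subComul hA ⟨x, hx⟩ - ⟨x, hx⟩ ⊗ₜ 1
    have hz : TensorProduct.map A.val.toLinearMap A.val.toLinearMap z =
        Coalgebra.comul (R := k) x - x ⊗ₜ 1 := by
      rw [map_sub, map_subComul]
      rfl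
    have hmem : z ∈ ⨆ (p : ℕ × ℕ) (_ : p.1 + p.2 = n ∧ p.1 < n), LinearMap.range
        (TensorProduct.map (subGrading A p.1).subtype (subGrading A p.2).subtype) :=
      mem_iSup_subGrading hA _ z fun p hp => by rw [hz, H.map_projLin_comul_sub hn hp]
    let T : H.carrier ⊗[k] H.carrier →ₗ[k] H.carrier :=
      LinearMap.mul' k H.carrier ∘ₗ (HopfAlgebra.antipode k).rTensor H.carrier
    have hle : (⨆ (p : ℕ × ℕ) (_ : p.1 + p.2 = n ∧ p.1 < n), LinearMap.range
        (TensorProduct.map (subGrading A p.1).subtype (subGrading A p.2).subtype)) ≤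
        (Subalgebra.toSubmodule A).comap
          (T ∘ₗ TensorProduct.map A.val.toLinearMap A.val.toLinearMap) := by
      refine iSup₂_le fun p hp => ?_
      rintro _ ⟨w, rfl⟩
      induction w with
      | zero => simp
      | add z w hz hw => rw [map_add]; exact add_mem hz hw
      | tmul y y' => exact A.mul_mem (ih p.1 hp.2 _ y.1.2 y.2) y'.1.2
    have h1 : T (Coalgebra.comul (R := k) x - x ⊗ₜ 1) ∈ A := by
      rw [← hz]
      exact hle hmem
    -- T sends Δ(x) to ε(x)1 by the antipode axiom, and x ⊗ 1 to S(x).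
    have h2 : T (Coalgebra.comul (R := k) x - x ⊗ₜ 1) =
        algebraMap k H.carrier (Coalgebra.counit x) - HopfAlgebra.antipode k x := by
      rw [map_sub]
      congr 1
      · exact HopfAlgebra.mul_antipode_rTensor_comul_apply x
      · simp [T]
    rw [h2] at h1
    have h3 := A.sub_mem (A.algebraMap_mem (Coalgebra.counit (R := k) x)) h1
    rwa [sub_sub_cancel] at h3

/-- A subalgebra that is a graded subcoalgebra is closed under the antipode. -/
theorem antipode_mem_of_mem (hA : IsGradedSubcoalgebra (Subalgebra.toSubmodule A))
    (x : H.carrier) (hx : x ∈ A) : HopfAlgebra.antipode k x ∈ A := by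
  obtain ⟨N, hN⟩ := DirectSum.exists_eq_sum_range_projLin H.grading x
  rw [← hN N le_rfl, map_sum]
  exact A.sum_mem fun n _ => antipode_mem_of_mem_grading hA n _ (hA.homogeneous x hx n)
    (SetLike.coe_mem _)

/-- The Hopf algebra structure of a subalgebra that is a graded subcoalgebra. -/
@[reducible]
def subHopf (hA : IsGradedSubcoalgebra (Subalgebra.toSubmodule A)) : HopfAlgebra k A :=
  hopfAlgebraOfInjective A.val Subtype.val_injective (subComul hA) (map_subComul hA)
    (LinearMap.codRestrict (Subalgebra.toSubmodule A)
      (HopfAlgebra.antipode k ∘ₗ A.val.toLinearMap) fun x => antipode_mem_of_mem hA x x.2)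
    (fun _ => rfl)

/-- A subalgebra that is a graded subcoalgebra, with the inherited structure, is a combinatorial
Hopf algebra. -/
def sub (hA : IsGradedSubcoalgebra (Subalgebra.toSubmodule A)) : CombHopfAlg.{u, v} k :=
  letI := subHopf hA
  letI := subGraded hA
  { carrier := A
    grading := subGrading A
    comul_mem := fun n x hx => mem_iSup_subGrading hA _ _ fun p hp =>
      (congrArg _ (map_subComul hA x)).trans
        (DirectSum.map_projLin_eq_zero_of_mem_iSup H.grading (H.comul_mem n x hx) hp)
    counit_eq_zero := fun n hn x hx => H.counit_eq_zero n hn x hx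
    antipode_mem := fun n x hx => H.antipode_mem n x hx
    connected := by
      ext x
      rw [Submodule.mem_one]
      constructor
      · intro hx
        have h : (x : H.carrier) ∈ H.grading 0 := hx
        rw [H.connected] at h
        obtain ⟨c, hc⟩ := Submodule.mem_one.1 h
        exact ⟨c, Subtype.ext hc⟩
      · rintro ⟨c, rfl⟩
        change algebraMap k H.carrier c ∈ H.grading 0
        rw [H.connected]
        exact Submodule.mem_one.2 ⟨c, rfl⟩
    finite := fun n => by
      have := H.finite n
      exact FiniteDimensional.of_injective
        (A.val.toLinearMap.restrict (p := subGrading A n) (q := H.grading n) fun _ h => h)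
        fun x y h => Subtype.ext (Subtype.ext (congrArg (H.grading n).subtype h))
    zeta := H.zeta.comp A.val }

/-- The inclusion of a sub-Hopf algebra, as a morphism. -/
def subIncl (hA : IsGradedSubcoalgebra (Subalgebra.toSubmodule A)) : (sub hA).Hom H where
  toBialgHom :=
    letI := subHopf hA
    BialgHom.ofAlgHom A.val rfl
      (AlgHom.toLinearMap_injective (LinearMap.ext fun x => map_subComul hA x))
  map_grading := fun _ _ hx => hx
  zeta_map := fun _ => rfl

theorem subIncl_injective (hA : IsGradedSubcoalgebra (Subalgebra.toSubmodule A)) :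
    Function.Injective (subIncl hA).toBialgHom := Subtype.val_injective

theorem image_subIncl (hA : IsGradedSubcoalgebra (Subalgebra.toSubmodule A)) :
    (subIncl hA).image = Subalgebra.toSubmodule A :=
  (LinearMap.range_eq_map _).trans ((Submodule.map_top _).trans
    (Submodule.range_subtype (Subalgebra.toSubmodule A)))

variable {K : CombHopfAlg.{u, w} k}

/-- A morphism with image in a sub-Hopf algebra factors through it. -/
def subLift (hA : IsGradedSubcoalgebra (Subalgebra.toSubmodule A))
    (f : K.Hom H) (hf : f.image ≤ Subalgebra.toSubmodule A) : K.Hom (sub hA) where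
  toBialgHom :=
    letI := subHopf hA
    BialgHom.ofAlgHom
      ((f.toBialgHom : K.carrier →ₐ[k] H.carrier).codRestrict A fun x => hf ⟨x, rfl⟩)
      (AlgHom.ext fun x => CoalgHomClass.counit_comp_apply f.toBialgHom x)
      (AlgHom.ext fun x => by
        let g : K.carrier →ₗ[k] A := ((f.toBialgHom : K.carrier →ₐ[k] H.carrier).codRestrict A
          fun x => hf ⟨x, rfl⟩).toLinearMap
        change TensorProduct.map g g (Coalgebra.comul x) = subComul hA (g x)
        -- Compatibility with the coproduct is tested in H ⊗ H, where it holds for f.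
        refine TensorProduct.map_self_injective (i := A.val.toLinearMap) Subtype.val_injective ?_
        rw [map_subComul, TensorProduct.map_map]
        exact (f.comul_apply x).symm)
  map_grading := fun n x hx => f.map_grading n x hx
  zeta_map := fun x => f.zeta_map x

end Sub

/-- Two morphisms into the subobject become equal in QSym by uniqueness there, and the inclusion is
injective. -/
theorem hom_sub_qsym_ext {A : Subalgebra k (qsymCHA k).carrier}
    (hA : IsGradedSubcoalgebra (Subalgebra.toSubmodule A)) {K : CombHopfAlg.{u, u} k}
    (f g : K.Hom (sub hA)) : f = g := by
  refine Hom.ext (BialgHom.ext fun x => subIncl_injective hA ?_)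
  have h : CategoryTheory.CategoryStruct.comp (Z := qsymCHA k) f (subIncl hA) =
      CategoryTheory.CategoryStruct.comp (Z := qsymCHA k) g (subIncl hA) := hom_qsym_ext _ _
  exact DFunLike.congr_fun (congrArg Hom.toBialgHom h) x

end CombHopfAlg

end

/-! ### The universal property and the two terminal objects. -/

theorem corollaryC (k : Type u) [Field k] :
    (∀ H : CombHopfAlg.{u, v} k, ∃ Ψ : H.Hom (qsymCHA k), (∀ Ψ' : H.Hom (qsymCHA k), Ψ' = Ψ) ∧
      (H.IsEven → Ψ.image ≤ PiPlus k) ∧ (H.IsOdd → Ψ.image ≤ PiMinus k)) ∧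
    (∃ (P : EvenCombHopfAlg.{u, u} k) (ι : P.obj ⟶ qsymCHA k),
      Function.Injective (CombHopfAlg.Hom.toBialgHom ι) ∧ CombHopfAlg.Hom.image ι = PiPlus k ∧
        Nonempty (CategoryTheory.Limits.IsTerminal P)) ∧
    (∃ (P : OddCombHopfAlg.{u, u} k) (ι : P.obj ⟶ qsymCHA k),
      Function.Injective (CombHopfAlg.Hom.toBialgHom ι) ∧ CombHopfAlg.Hom.image ι = PiMinus k ∧
        Nonempty (CategoryTheory.Limits.IsTerminal P)) := by
  refine ⟨fun H => ⟨H.homQSym, fun Ψ' => CombHopfAlg.hom_qsym_ext _ _,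
    H.homQSym.image_le_evenSubalgebra, H.homQSym.image_le_oddSubalgebra⟩, ?_, ?_⟩
  -- The underlying subspace of A is Π₊ by definition; writing ζ̄ as a morphism of algebras is what
  -- makes it a subalgebra.
  · let A := (qsymCHA k).eqSubalgebra (qsymCHA k).zetaBarAlgHom (qsymCHA k).zeta
    have hA := (qsymCHA k).isGreatest_eqSubcoalgebra (qsymCHA k).zetaBar
      (qsymCHA k).zeta.toLinearMap
    have hA1 : CombHopfAlg.IsGradedSubcoalgebra (Subalgebra.toSubmodule A) := hA.1.1
    refine ⟨⟨CombHopfAlg.sub hA1, ?_⟩, CombHopfAlg.subIncl hA1, CombHopfAlg.subIncl_injective hA1,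
      CombHopfAlg.image_subIncl hA1, ⟨?_⟩⟩
    · refine LinearMap.ext fun x => ?_
      -- ζ̄ of the subobject is the restriction of ζ̄ from QSym, so evenness is the agreement that
      -- defines Π₊.
      rw [← (CombHopfAlg.subIncl hA1).zetaBar_apply]
      exact hA.1.2 _ x.2
    · refine CategoryTheory.Limits.IsTerminal.ofUniqueHom (fun K => ⟨CombHopfAlg.subLift hA1
        K.obj.homQSym (K.obj.homQSym.image_le_evenSubalgebra K.property)⟩) fun K m => ?_
      exact CategoryTheory.ObjectProperty.hom_ext _ (CombHopfAlg.hom_sub_qsym_ext hA1 _ _)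
  · let A := (qsymCHA k).eqSubalgebra (qsymCHA k).zetaBarAlgHom (qsymCHA k).zetaInvAlgHom
    have hA := (qsymCHA k).isGreatest_eqSubcoalgebra (qsymCHA k).zetaBar (qsymCHA k).zetaInv
    have hA1 : CombHopfAlg.IsGradedSubcoalgebra (Subalgebra.toSubmodule A) := hA.1.1
    refine ⟨⟨CombHopfAlg.sub hA1, ?_⟩, CombHopfAlg.subIncl hA1, CombHopfAlg.subIncl_injective hA1,
      CombHopfAlg.image_subIncl hA1, ⟨?_⟩⟩
    · refine LinearMap.ext fun x => ?_
      -- ζ⁻¹ restricts as well, because the inclusion commutes with the antipodes.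
      rw [← (CombHopfAlg.subIncl hA1).zetaBar_apply, ← (CombHopfAlg.subIncl hA1).zetaInv_apply]
      exact hA.1.2 _ x.2
    · refine CategoryTheory.Limits.IsTerminal.ofUniqueHom (fun K => ⟨CombHopfAlg.subLift hA1
        K.obj.homQSym (K.obj.homQSym.image_le_oddSubalgebra K.property)⟩) fun K m => ?_
      exact CategoryTheory.ObjectProperty.hom_ext _ (CombHopfAlg.hom_sub_qsym_ext hA1 _ _)
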